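/- Let $\mathcal D(n,p)$ denote the random digraph on vertex set $[n]=\{1,\dots,n\}$ in which each of the $n(n-1)$ arcs $(u,v)$ with $u\neq v$ is present independently with probability $p$. A directed Hamilton cycle of a digraph is a directed cycle passing through every vertex exactly once; two such cycles are distinct if their arc sets differ. Let $p=p(n)\in[0,1]$ satisfy $p=\omega\!\left(\frac{\log^2 n}{n}\right)$ as $n\to\infty$, and let $X_n$ be the number of directed Hamilton cycles of $D\sim\mathcal D(n,p(n))$. Then with high probability $X_n=(1\pm o(1))^n\,n!\,p^n$; that is, there is a sequence $\varepsilon_n\in[0,1)$ with $\varepsilon_n\to 0$ such that $$\lim_{n\to\infty}\Pr\Big[(1-\varepsilon_n)^n\,n!\,p(n)^n\;\le\; X_n\;\le\;(1+\varepsilon_n)^n\,n!\,p(n)^n\Big]=1 .$$ -/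

import Mathlib

open Filter Topology MeasureTheory ProbabilityTheory Asymptotics
open scoped unitInterval

namespace Digraph

/-- The digraph on `V` whose arcs are the ordered pairs in `A`. -/
def ofArcSet {V : Type*} (A : Set (V × V)) : Digraph V where
  Adj u v := (u, v) ∈ A

/-- A digraph `H` on `V` is a directed Hamilton cycle (on the vertex set `V`) if there are at least
two vertices and they can be listed, each exactly once, as `v 0, …, v (k - 1)` so that the arcs of
`H` are exactly `v 0 → v 1 → ⋯ → v (k - 1) → v 0`. Here `finRotate k` is `i ↦ i + 1` modulo `k`. -/
def IsHamiltonCycle {V : Type*} (H : Digraph V) : Prop :=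
  ∃ (k : ℕ) (v : Fin k ≃ V), 2 ≤ k ∧
    ∀ x y : V, H.Adj x y ↔ ∃ i : Fin k, x = v i ∧ y = v (finRotate k i)

/-- The number of directed Hamilton cycles contained in `D`; a cycle is identified with the
subdigraph formed by its arcs, so that rotations of a vertex list are not counted separately. -/
noncomputable def hamiltonCycleCount {V : Type*} (D : Digraph V) : ℕ :=
  {H : Digraph V | H.IsHamiltonCycle ∧ H ≤ D}.ncard

instance instMeasurableSpace {V : Type*} : MeasurableSpace (Digraph V) := ⊤

/-- The random digraph `𝒟(n, p)` on `n` labelled vertices: each of the `n (n - 1)` arcs `(u, v)`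
with `u ≠ v` is present with probability `p`, independently; there are no loops. -/
noncomputable def binomialRandom (n : ℕ) (p : I) : Measure (Digraph (Fin n)) :=
  (setBernoulli {e : Fin n × Fin n | e.1 ≠ e.2} p).map ofArcSet

instance instIsProbabilityMeasure (n : ℕ) (p : I) : IsProbabilityMeasure (binomialRandom n p) :=
  Measure.isProbabilityMeasure_map (measurable_of_countable _).aemeasurable

end Digraph

/-! The upper bound is Markov's inequality: the expected number of cycles is at most `n! p^n`, and a
factor `(1+ε)^n` makes the failure probability vanish (`pr_card_cyclesIn_gt_le`). All the work is in
the lower bound.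

The second moment alone gives too little. Two random cycles share enough arcs that `E[X²]` is
bounded only by `n e^{1/p} (E X)²`, so `X ≥ E X / 2` is known just with probability at least
`e^{-1/p} / (4n)` (`le_pr_card_cyclesIn_ge`). Concentration makes up for this. Regard the digraph as
a point of a product of `n` coordinates, the out-neighbourhoods. An event of probability well above
`e^{-r²/(4n)}` is, for almost every digraph, at most `r` coordinates away
(`pr_mul_pr_not_hammingClose_le`). Hence, off a set `R` of `r` vertices, a typical digraph agrees
with one that has many Hamilton cycles.

To repair the arcs leaving `R`, write the digraph as a union of independent ones with densities `p₁`
and `p₂`, where `p₁` is nearly `p` and `p₂` is a small multiple of it. Delete from a cycle its arcs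
out of `R` and contract the remaining paths: the `p₂`-arcs form a binomial random digraph on `R`,
which is Hamiltonian with high probability once `p₂` exceeds a multiple of `log r / r`. A Hamilton
cycle there completes the path forest, and at most `r!` original cycles lead to the same completion
(`pr_few_completions_le`, `pr_card_cyclesIn_lt_le`).

With `r ≈ η n / log n` the loss `r!` is at most `e^{ηn}`. The conditions `1/p ≪ r²/n` and `p ≫ log r
/ r` both follow from `p ≫ log² n / n`.

Hamiltonicity of the random digraph (`pr_not_nonempty_cyclesIn_le`) is reduced to that of the random
graph by McDiarmid's coupling (`pr_diag_le`), and for graphs it is proved by Pósa rotations and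
sprinkling of boosters (`Expands.exists_boosters`, `pr_not_hasLongPath_le`). The error `ε` is first
fixed and then sent to zero by a diagonal argument. -/

/-! ### Expectations with respect to weights on finite types -/

section FiniteExpectation

variable {Ω Ω' ι κ : Type*} [Fintype Ω] [Fintype Ω'] [Fintype ι] [Fintype κ]

/-- The expectation of `f` with respect to the weight `w`. -/
noncomputable def ex (w : Ω → ℝ) (f : Ω → ℝ) : ℝ := ∑ x, w x * f x

open Classical in
/-- The probability of the event `s` with respect to the weight `w`. -/
noncomputable def pr (w : Ω → ℝ) (s : Ω → Prop) : ℝ := ex w fun x => if s x then 1 else 0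

/-- `w` is a probability weight. -/
structure IsProbWeight (w : Ω → ℝ) : Prop where
  nonneg : ∀ x, 0 ≤ w x
  sum_eq_one : ∑ x, w x = 1

/-- The product weight on `ι → Ω`. -/
noncomputable def piWeight (ι : Type*) [Fintype ι] (w : Ω → ℝ) : (ι → Ω) → ℝ :=
  fun ω => ∏ i, w (ω i)

/-- The Bernoulli weight with parameter `q`. -/
noncomputable def bern (q : ℝ) : Bool → ℝ := fun b => if b then q else 1 - q

lemma isProbWeight_bern {q : ℝ} (h0 : 0 ≤ q) (h1 : q ≤ 1) : IsProbWeight (bern q) := by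
  refine ⟨?_, by simp [bern]⟩
  rintro (_ | _) <;> simp [bern, h0, h1]

lemma IsProbWeight.pi [DecidableEq ι] {w : Ω → ℝ} (hw : IsProbWeight w) :
    IsProbWeight (piWeight ι w) := by
  refine ⟨fun ω => Finset.prod_nonneg fun i _ => hw.nonneg _, ?_⟩
  have := (Finset.prod_univ_sum (fun _ : ι => (Finset.univ : Finset Ω)) (fun _ x => w x))
  simp only [hw.sum_eq_one, Finset.prod_const_one, Fintype.piFinset_univ] at this
  exact this.symm

lemma ex_const {w : Ω → ℝ} (hw : IsProbWeight w) (c : ℝ) : ex w (fun _ => c) = c := by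
  simp [ex, ← Finset.sum_mul, hw.sum_eq_one]

lemma ex_mono {w : Ω → ℝ} (hw : IsProbWeight w) {f g : Ω → ℝ} (h : ∀ x, f x ≤ g x) :
    ex w f ≤ ex w g :=
  Finset.sum_le_sum fun x _ => mul_le_mul_of_nonneg_left (h x) (hw.nonneg x)

lemma ex_nonneg {w : Ω → ℝ} (hw : IsProbWeight w) {f : Ω → ℝ} (h : ∀ x, 0 ≤ f x) : 0 ≤ ex w f :=
  Finset.sum_nonneg fun x _ => mul_nonneg (hw.nonneg x) (h x)

lemma ex_add (w f g : Ω → ℝ) : ex w (fun x => f x + g x) = ex w f + ex w g := by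
  simp [ex, mul_add, Finset.sum_add_distrib]

lemma ex_sub (w f g : Ω → ℝ) : ex w (fun x => f x - g x) = ex w f - ex w g := by
  simp [ex, mul_sub, Finset.sum_sub_distrib]

lemma ex_const_mul (w : Ω → ℝ) (c : ℝ) (f : Ω → ℝ) : ex w (fun x => c * f x) = c * ex w f := by
  simp only [ex, Finset.mul_sum]
  exact Finset.sum_congr rfl fun x _ => by ring

lemma ex_sum {α : Type*} (w : Ω → ℝ) (s : Finset α) (f : α → Ω → ℝ) :
    ex w (fun x => ∑ a ∈ s, f a x) = ∑ a ∈ s, ex w (f a) := by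
  simp only [ex, Finset.mul_sum]
  exact Finset.sum_comm

lemma ex_comm (w : Ω → ℝ) (w' : Ω' → ℝ) (f : Ω → Ω' → ℝ) :
    ex w (fun x => ex w' (f x)) = ex w' (fun y => ex w (fun x => f x y)) := by
  simp only [ex, Finset.mul_sum]
  rw [Finset.sum_comm]
  exact Finset.sum_congr rfl fun x _ => Finset.sum_congr rfl fun y _ => by ring

lemma ex_equiv (e : Ω ≃ Ω') (w' : Ω' → ℝ) (f : Ω' → ℝ) :
    ex (fun x => w' (e x)) (fun x => f (e x)) = ex w' f :=
  e.sum_comp fun y => w' y * f y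

lemma pr_nonneg {w : Ω → ℝ} (hw : IsProbWeight w) (s : Ω → Prop) : 0 ≤ pr w s :=
  ex_nonneg hw fun x => by split_ifs <;> norm_num

lemma pr_mono {w : Ω → ℝ} (hw : IsProbWeight w) {s t : Ω → Prop} (h : ∀ x, s x → t x) :
    pr w s ≤ pr w t :=
  ex_mono hw fun x => by
    by_cases hs : s x
    · simp [hs, h x hs]
    · simp only [hs, if_false]; split_ifs <;> norm_num

lemma pr_le_one {w : Ω → ℝ} (hw : IsProbWeight w) (s : Ω → Prop) : pr w s ≤ 1 := by
  rw [← ex_const hw 1]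
  exact ex_mono hw fun x => by split_ifs <;> norm_num

lemma pr_not {w : Ω → ℝ} (hw : IsProbWeight w) (s : Ω → Prop) :
    pr w (fun x => ¬ s x) = 1 - pr w s := by
  rw [← ex_const hw 1, pr, pr, ← ex_sub]
  congr 1
  ext x
  by_cases hs : s x <;> simp [hs]

lemma pr_or_le {w : Ω → ℝ} (hw : IsProbWeight w) (s t : Ω → Prop) :
    pr w (fun x => s x ∨ t x) ≤ pr w s + pr w t := by
  rw [pr, pr, pr, ← ex_add]
  exact ex_mono hw fun x => by by_cases hs : s x <;> by_cases ht : t x <;> simp [hs, ht]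

lemma pr_exists_le {α : Type*} {w : Ω → ℝ} (hw : IsProbWeight w) (A : Finset α)
    (s : α → Ω → Prop) : pr w (fun x => ∃ a ∈ A, s a x) ≤ ∑ a ∈ A, pr w (s a) := by
  classical
  simp only [pr]
  rw [← ex_sum]
  refine ex_mono hw fun x => ?_
  split_ifs with h
  · obtain ⟨a, ha, hs⟩ := h
    refine le_trans (by simp [hs]) (Finset.single_le_sum (f := fun a => if s a x then (1 : ℝ) else 0)
      (fun b _ => by split_ifs <;> norm_num) ha)
  · exact Finset.sum_nonneg fun b _ => by split_ifs <;> norm_num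

lemma mul_pr_le_ex {w : Ω → ℝ} (hw : IsProbWeight w) {f : Ω → ℝ} (hf : ∀ x, 0 ≤ f x) (c : ℝ) :
    c * pr w (fun x => c ≤ f x) ≤ ex w f := by
  rw [pr, ← ex_const_mul]
  refine ex_mono hw fun x => ?_
  split_ifs with h
  · simpa using h
  · simpa using hf x

/-- The basic tool for two-round exposure: the first round fails with probability `pr w s`, and
otherwise the second round fails with probability at most `δ`. -/
lemma pr_le_add_ex_pr {w : Ω → ℝ} (hw : IsProbWeight w) {w' : Ω' → ℝ} (hw' : IsProbWeight w')
    {s : Ω → Prop} {t : Ω → Ω' → Prop} {δ : ℝ} (hδ : 0 ≤ δ)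
    (h : ∀ x, ¬ s x → pr w' (t x) ≤ δ) :
    ex w (fun x => pr w' (t x)) ≤ pr w s + δ := by
  rw [← ex_const hw δ, pr, ← ex_add]
  refine ex_mono hw fun x => ?_
  split_ifs with hs
  · linarith [pr_le_one hw' (t x)]
  · simpa using h x hs

lemma ex_piWeight_prod [DecidableEq ι] (w : Ω → ℝ) (g : ι → Ω → ℝ) :
    ex (piWeight ι w) (fun ω => ∏ i, g i (ω i)) = ∏ i, ex w (g i) := by
  simp only [ex, piWeight, ← Finset.prod_mul_distrib]
  rw [Finset.prod_univ_sum (fun _ : ι => (Finset.univ : Finset Ω)) (fun i x => w x * g i x),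
    Fintype.piFinset_univ]

lemma ex_piWeight_reindex [DecidableEq ι] [DecidableEq κ] (w : Ω → ℝ) (e : ι ≃ κ)
    (f : (ι → Ω) → ℝ) :
    ex (piWeight κ w) (fun ω => f (ω ∘ e)) = ex (piWeight ι w) f := by
  rw [← ex_equiv (e.symm.arrowCongr (Equiv.refl Ω)) (piWeight ι w) f]
  unfold ex
  refine Finset.sum_congr rfl fun ω _ => ?_
  congr 1
  simp only [piWeight]
  rw [← e.prod_comp]
  rfl

lemma ex_piWeight_sum [DecidableEq ι] [DecidableEq κ] (w : Ω → ℝ) (f : (ι ⊕ κ → Ω) → ℝ) :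
    ex (piWeight (ι ⊕ κ) w) f =
      ex (piWeight ι w) (fun a => ex (piWeight κ w) (fun b => f (Sum.elim a b))) := by
  rw [← ex_equiv (Equiv.sumArrowEquivProdArrow ι κ Ω).symm]
  unfold ex
  rw [Fintype.sum_prod_type]
  refine Finset.sum_congr rfl fun a _ => ?_
  rw [Finset.mul_sum]
  refine Finset.sum_congr rfl fun b _ => ?_
  rw [← mul_assoc]
  congr 1
  simp [piWeight, Equiv.sumArrowEquivProdArrow]

/-- Coordinates outside the range of `g` integrate out. This transports events to random digraphs on
smaller or relabelled arc sets. -/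
lemma ex_piWeight_comp [DecidableEq ι] [DecidableEq κ] {w : Ω → ℝ} (hw : IsProbWeight w)
    {g : κ → ι} (hg : Function.Injective g) (f : (κ → Ω) → ℝ) :
    ex (piWeight ι w) (fun ω => f (ω ∘ g)) = ex (piWeight κ w) f := by
  classical
  let e : κ ⊕ {i // i ∉ Set.range g} ≃ ι :=
    ((Equiv.ofInjective g hg).sumCongr (Equiv.refl _)).trans (Equiv.Set.sumCompl (Set.range g))
  have he : ∀ k, e (Sum.inl k) = g k := fun k => rfl
  have h1 := ex_piWeight_reindex w e (fun ω => f (ω ∘ Sum.inl))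
  have h2 : (fun ω : ι → Ω => f ((ω ∘ e) ∘ Sum.inl)) = fun ω => f (ω ∘ g) := by
    ext ω; congr 1
  rw [h2] at h1
  rw [h1, ex_piWeight_sum]
  simp only [Sum.elim_comp_inl]
  congr 1
  ext a
  exact ex_const hw.pi _

lemma pr_piWeight_comp [DecidableEq ι] [DecidableEq κ] {w : Ω → ℝ} (hw : IsProbWeight w)
    {g : κ → ι} (hg : Function.Injective g) (s : (κ → Ω) → Prop) :
    pr (piWeight ι w) (fun ω => s (ω ∘ g)) = pr (piWeight κ w) s := by
  classical
  exact ex_piWeight_comp hw hg (fun η => if s η then 1 else 0)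

lemma ex_piWeight_map [DecidableEq ι] [DecidableEq Ω'] (w : Ω → ℝ) (w' : Ω' → ℝ) (h : Ω → Ω')
    (hh : ∀ c, ∑ a with h a = c, w a = w' c) (f : (ι → Ω') → ℝ) :
    ex (piWeight ι w) (fun ω => f (h ∘ ω)) = ex (piWeight ι w') f := by
  classical
  unfold ex
  rw [← Finset.sum_fiberwise (s := Finset.univ) (g := fun ω : ι → Ω => h ∘ ω)]
  refine Finset.sum_congr rfl fun c _ => ?_
  have : ∀ ω ∈ Finset.univ.filter (fun ω : ι → Ω => h ∘ ω = c),
      piWeight ι w ω * f (h ∘ ω) = piWeight ι w ω * f c := by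
    intro ω hω
    rw [(Finset.mem_filter.1 hω).2]
  rw [Finset.sum_congr rfl this, ← Finset.sum_mul]
  congr 1
  have h3 : Finset.univ.filter (fun ω : ι → Ω => h ∘ ω = c) =
      Fintype.piFinset (fun i => Finset.univ.filter (fun a => h a = c i)) := by
    ext ω
    simp [funext_iff]
  rw [h3]
  simp only [piWeight]
  rw [← Finset.prod_univ_sum]
  exact Finset.prod_congr rfl fun i _ => hh _

lemma ex_piWeight_pair [DecidableEq ι] (w : Ω → ℝ) (w' : Ω' → ℝ)
    (f : (ι → Ω) → (ι → Ω') → ℝ) :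
    ex (piWeight ι w) (fun a => ex (piWeight ι w') (f a)) =
      ex (piWeight ι (fun x : Ω × Ω' => w x.1 * w' x.2))
        (fun ω => f (fun i => (ω i).1) (fun i => (ω i).2)) := by
  rw [← ex_equiv (Equiv.arrowProdEquivProdArrow ι (fun _ => Ω) (fun _ => Ω')).symm]
  unfold ex
  rw [Fintype.sum_prod_type]
  refine Finset.sum_congr rfl fun a _ => ?_
  rw [Finset.mul_sum]
  refine Finset.sum_congr rfl fun b _ => ?_
  rw [← mul_assoc]
  congr 1
  simp [piWeight, Equiv.arrowProdEquivProdArrow, Finset.prod_mul_distrib]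

/-- The union of independent binomial random sets is a binomial random set. -/
lemma ex_bern_sup [DecidableEq ι] {p p₁ p₂ : ℝ} (h : 1 - p = (1 - p₁) * (1 - p₂))
    (f : (ι → Bool) → ℝ) :
    ex (piWeight ι (bern p₁)) (fun a => ex (piWeight ι (bern p₂)) (fun b => f (a ⊔ b))) =
      ex (piWeight ι (bern p)) f := by
  rw [ex_piWeight_pair]
  rw [← ex_piWeight_map (fun x : Bool × Bool => bern p₁ x.1 * bern p₂ x.2) (bern p)
    (fun x => x.1 ⊔ x.2)]
  · rfl
  · rintro (_ | _)
    · have : (Finset.univ.filter (fun a : Bool × Bool => a.1 ⊔ a.2 = false)) =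
        {(false, false)} := by decide
      rw [this]; simp [bern, h]
    · have : (Finset.univ.filter (fun a : Bool × Bool => a.1 ⊔ a.2 = true)) =
        {(false, true), (true, false), (true, true)} := by decide
      rw [this]; simp [bern]; linear_combination h

lemma pr_bern_sup [DecidableEq ι] {p p₁ p₂ : ℝ} (h : 1 - p = (1 - p₁) * (1 - p₂))
    (s : (ι → Bool) → Prop) :
    ex (piWeight ι (bern p₁)) (fun a => pr (piWeight ι (bern p₂)) (fun b => s (a ⊔ b))) =
      pr (piWeight ι (bern p)) s := by
  classical
  exact ex_bern_sup h (fun a => if s a then 1 else 0)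

lemma pr_bern_mono [DecidableEq ι] {q p : ℝ} (hq : 0 ≤ q) (hqp : q ≤ p) (hp : p ≤ 1)
    {s : (ι → Bool) → Prop} (hs : Monotone s) :
    pr (piWeight ι (bern q)) s ≤ pr (piWeight ι (bern p)) s := by
  classical
  rcases eq_or_lt_of_le (hqp.trans hp) with h1 | h1
  · have : q = p := le_antisymm hqp (by linarith)
    rw [this]
  have hw := (isProbWeight_bern hq h1.le).pi (ι := ι)
  -- This density satisfies `1 - p = (1 - q)(1 - p₂)`, so the `p`-set is the `q`-set together with
  -- an independent one.
  have hw2 := (isProbWeight_bern (q := (p - q) / (1 - q))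
    (div_nonneg (by linarith) (by linarith))
    ((div_le_one (by linarith)).2 (by linarith))).pi (ι := ι)
  rw [← pr_bern_sup (p := p) (p₁ := q) (p₂ := (p - q) / (1 - q))]
  · refine ex_mono hw fun a => ?_
    rw [← ex_const hw2 (if s a then 1 else 0)]
    refine ex_mono hw2 fun b => ?_
    split_ifs with h2 h3
    · exact le_rfl
    · exact absurd (hs le_sup_left h2) h3
    · norm_num
    · exact le_rfl
  · have : 1 - q ≠ 0 := by linarith
    field_simp
    ring

lemma pr_bern_forall_true [DecidableEq ι] {q : ℝ} (B : Finset ι) :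
    pr (piWeight ι (bern q)) (fun ω => ∀ i ∈ B, ω i = true) = q ^ B.card := by
  have := ex_piWeight_prod (ι := ι) (bern q)
    (fun i b => if i ∈ B then (if b then 1 else 0) else 1)
  have h2 : ∀ i, ex (bern q) (fun b => if i ∈ B then (if b then (1:ℝ) else 0) else 1) =
      if i ∈ B then q else 1 := by
    intro i; by_cases hi : i ∈ B <;> simp [ex, bern, hi]
  rw [Finset.prod_congr rfl (fun i _ => h2 i), Finset.prod_ite_mem, Finset.univ_inter,
    Finset.prod_const] at this
  rw [← this, pr]
  congr 1
  ext ω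
  rw [Finset.prod_ite_mem, Finset.univ_inter, Finset.prod_ite_zero]
  simp

lemma pr_bern_forall_false [DecidableEq ι] {q : ℝ} (B : Finset ι) :
    pr (piWeight ι (bern q)) (fun ω => ∀ i ∈ B, ω i = false) = (1 - q) ^ B.card := by
  have := ex_piWeight_prod (ι := ι) (bern q)
    (fun i b => if i ∈ B then (if b = false then 1 else 0) else 1)
  have h2 : ∀ i, ex (bern q) (fun b => if i ∈ B then (if b = false then (1:ℝ) else 0) else 1) =
      if i ∈ B then 1 - q else 1 := by
    intro i; by_cases hi : i ∈ B <;> simp [ex, bern, hi]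
  rw [Finset.prod_congr rfl (fun i _ => h2 i), Finset.prod_ite_mem, Finset.univ_inter,
    Finset.prod_const] at this
  rw [← this, pr]
  congr 1
  ext ω
  rw [Finset.prod_ite_mem, Finset.univ_inter, Finset.prod_ite_zero]
  simp

lemma ex_piWeight_curry [DecidableEq ι] [DecidableEq κ] (w : Ω → ℝ) (f : (ι × κ → Ω) → ℝ) :
    ex (piWeight (ι × κ) w) f =
      ex (piWeight ι (piWeight κ w)) (fun ω => f (fun e => ω e.1 e.2)) := by
  rw [← ex_equiv (Equiv.curry ι κ Ω).symm]
  unfold ex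
  refine Finset.sum_congr rfl fun a _ => ?_
  congr 1
  simp only [piWeight, Fintype.prod_prod_type]
  rfl

lemma ex_piWeight_cons {n : ℕ} (w : Ω → ℝ) (f : (Fin (n + 1) → Ω) → ℝ) :
    ex (piWeight (Fin (n + 1)) w) f =
      ex (piWeight (Fin n) w) (fun ω => ex w (fun x => f (Fin.cons x ω))) := by
  rw [ex_comm, ← ex_equiv (Fin.consEquiv (fun _ => Ω))]
  unfold ex
  rw [Fintype.sum_prod_type]
  refine Finset.sum_congr rfl fun a _ => ?_
  rw [Finset.mul_sum]
  refine Finset.sum_congr rfl fun b _ => ?_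
  rw [← mul_assoc]
  congr 1
  simp [piWeight, Fin.consEquiv, Fin.prod_univ_succ]

end FiniteExpectation

/-! ### Concentration in Hamming space -/

section Concentration

variable {Ω : Type*} [Fintype Ω]

lemma exp_mul_le_cosh_add {t : ℝ} (l : ℝ) (h0 : -1 ≤ t) (h1 : t ≤ 1) :
    Real.exp (l * t) ≤ Real.cosh l + t * Real.sinh l := by
  have := convexOn_exp.2 (Set.mem_univ l) (Set.mem_univ (-l))
    (show 0 ≤ (1 + t) / 2 by linarith) (show 0 ≤ (1 - t) / 2 by linarith) (by ring)
  simp only [smul_eq_mul] at this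
  rw [show (1 + t) / 2 * l + (1 - t) / 2 * -l = l * t by ring] at this
  rw [Real.cosh_eq, Real.sinh_eq]
  linarith

/-- The centred variable has mean zero and lies in `[-1, 1]`. Bounding the exponential by its chord
there leaves `cosh l ≤ exp (l² / 2)`. -/
lemma ex_exp_le_of_osc {w : Ω → ℝ} (hw : IsProbWeight w) (g : Ω → ℝ)
    (hg : ∀ x y, g x - g y ≤ 1) (l : ℝ) :
    ex w (fun x => Real.exp (l * g x)) ≤ Real.exp (l * ex w g + l ^ 2 / 2) := by
  set m := ex w g with hm
  have h1 : ∀ x, g x - m ≤ 1 := by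
    intro x
    have : ex w (fun y => g x - 1) ≤ ex w g := ex_mono hw fun y => by linarith [hg x y]
    rw [ex_const hw] at this
    linarith
  have h2 : ∀ x, -1 ≤ g x - m := by
    intro x
    have : ex w g ≤ ex w (fun y => g x + 1) := ex_mono hw fun y => by linarith [hg y x]
    rw [ex_const hw] at this
    linarith
  have h3 : ex w (fun x => Real.exp (l * (g x - m))) ≤ Real.cosh l := by
    calc _ ≤ ex w (fun x => Real.cosh l + Real.sinh l * (g x - m)) :=
          ex_mono hw fun x => by
            rw [mul_comm (Real.sinh l)]; exact exp_mul_le_cosh_add l (h2 x) (h1 x)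
      _ = Real.cosh l := by
        rw [ex_add, ex_const hw, ex_const_mul, ex_sub, ex_const hw]; simp [hm]
  have h4 : ex w (fun x => Real.exp (l * g x)) =
      Real.exp (l * m) * ex w (fun x => Real.exp (l * (g x - m))) := by
    rw [← ex_const_mul]
    congr 1; ext x
    rw [← Real.exp_add]; ring_nf
  rw [h4, Real.exp_add]
  exact mul_le_mul_of_nonneg_left (h3.trans (Real.cosh_le_exp_half_sq l)) (Real.exp_nonneg _)

/-- Induction on the number of coordinates: averaging over the first one costs a factor `exp (l² /
2)` and leaves a function that is still Lipschitz in the others. -/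
lemma ex_exp_le_of_lipschitz {w : Ω → ℝ} (hw : IsProbWeight w) (l : ℝ) :
    ∀ (n : ℕ) (f : (Fin n → Ω) → ℝ), (∀ ω i x, f (Function.update ω i x) - f ω ≤ 1) →
    ex (piWeight (Fin n) w) (fun ω => Real.exp (l * f ω)) ≤
      Real.exp (l * ex (piWeight (Fin n) w) f + n * (l ^ 2 / 2)) := by
  intro n
  induction n with
  | zero =>
    intro f _
    simp [ex, piWeight]
  | succ n ih =>
    intro f hf
    have hp := hw.pi (ι := Fin n)
    set g : (Fin n → Ω) → ℝ := fun ω => ex w (fun x => f (Fin.cons x ω)) with hg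
    have hgl : ∀ ω i x, g (Function.update ω i x) - g ω ≤ 1 := by
      intro ω i x
      rw [hg]; dsimp only
      rw [← ex_sub, ← ex_const hw 1]
      refine ex_mono hw fun y => ?_
      rw [Fin.cons_update]
      exact hf _ _ _
    rw [ex_piWeight_cons, ex_piWeight_cons]
    calc _ ≤ ex (piWeight (Fin n) w) (fun ω => Real.exp (l ^ 2 / 2) * Real.exp (l * g ω)) := by
          refine ex_mono hp fun ω => ?_
          rw [← Real.exp_add, add_comm (l ^ 2 / 2)]
          refine ex_exp_le_of_osc hw _ (fun x y => ?_) l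
          have := hf (Fin.cons y ω) 0 x
          rwa [Fin.update_cons_zero] at this
      _ ≤ _ := by
        rw [ex_const_mul]
        refine (mul_le_mul_of_nonneg_left (ih g hgl) (Real.exp_nonneg _)).trans (le_of_eq ?_)
        rw [← Real.exp_add]
        push_cast
        congr 1
        change _ = l * ex (piWeight (Fin n) w) g + _
        ring

/-- `ω` can be moved into `S` by changing at most `r` coordinates. -/
def HammingClose {n : ℕ} (S : (Fin n → Ω) → Prop) (r : ℕ) (ω : Fin n → Ω) : Prop :=
  ∃ R : Finset (Fin n), R.card ≤ r ∧ ∃ ω', S ω' ∧ ∀ i ∉ R, ω i = ω' i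

/-- The Hamming distance to `S` is Lipschitz, vanishes on `S` and is at least `r` on the far set.
The exponential moments at `-l` and `l` bound the two probabilities, and the unknown mean cancels in
their product. -/
lemma pr_mul_pr_not_hammingClose_le {w : Ω → ℝ} (hw : IsProbWeight w) {n : ℕ} (hn : 0 < n)
    (S : (Fin n → Ω) → Prop) (r : ℕ) :
    pr (piWeight (Fin n) w) S * pr (piWeight (Fin n) w) (fun ω => ¬ HammingClose S r ω) ≤
      Real.exp (-(r : ℝ) ^ 2 / (4 * n)) := by
  classical
  have hp := hw.pi (ι := Fin n)
  by_cases hS : ∃ ω, S ω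
  swap
  · have : pr (piWeight (Fin n) w) S = 0 := by
      push Not at hS
      simp [pr, hS, ex]
    rw [this, zero_mul]
    exact Real.exp_nonneg _
  obtain ⟨ω₀, hω₀⟩ := hS
  let D : (Fin n → Ω) → Set ℕ := fun ω => {k | ∃ ω', S ω' ∧ hammingDist ω ω' = k}
  have hD : ∀ ω, (D ω).Nonempty := fun ω => ⟨_, ω₀, hω₀, rfl⟩
  let d : (Fin n → Ω) → ℝ := fun ω => (sInf (D ω) : ℕ)
  have hdl : ∀ ω i x, d (Function.update ω i x) - d ω ≤ 1 := by
    intro ω i x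
    obtain ⟨ω', h1, h2⟩ := Nat.sInf_mem (hD ω)
    have h3 : sInf (D (Function.update ω i x)) ≤ hammingDist (Function.update ω i x) ω' :=
      Nat.sInf_le ⟨ω', h1, rfl⟩
    have h4 : hammingDist (Function.update ω i x) ω' ≤ 1 + hammingDist ω ω' := by
      refine (hammingDist_triangle _ ω _).trans (Nat.add_le_add_right ?_ _)
      unfold hammingDist
      refine (Finset.card_le_card (t := {i}) ?_).trans (by simp)
      intro j hj
      by_contra hji
      simp only [Finset.mem_singleton] at hji
      simp [hji] at hj
    have h5 : sInf (D (Function.update ω i x)) ≤ 1 + sInf (D ω) := by omega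
    have h6 : ((sInf (D (Function.update ω i x)) : ℕ) : ℝ) ≤ 1 + (sInf (D ω) : ℕ) := by exact_mod_cast h5
    simp only [d]; linarith
  have hd0 : ∀ ω, S ω → d ω = 0 := by
    intro ω h
    have : sInf (D ω) ≤ 0 := Nat.sInf_le ⟨ω, h, hammingDist_self ω⟩
    simp only [d]; exact_mod_cast Nat.le_zero.1 this
  have hdr : ∀ ω, ¬ HammingClose S r ω → (r : ℝ) ≤ d ω := by
    intro ω h
    by_contra hlt
    apply h
    obtain ⟨ω', h1, h2⟩ := Nat.sInf_mem (hD ω)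
    refine ⟨Finset.univ.filter (fun i => ω i ≠ ω' i), ?_, ω', h1, fun i hi => by simpa using hi⟩
    have : ((sInf (D ω) : ℕ) : ℝ) < r := by simpa [d] using hlt
    have h3 : sInf (D ω) < r := by exact_mod_cast this
    have h4 : (Finset.univ.filter (fun i => ω i ≠ ω' i)).card = hammingDist ω ω' := rfl
    omega
  -- This value minimises the resulting exponent `n l² - l r`.
  set l : ℝ := r / (2 * n) with hl
  have hl0 : 0 ≤ l := by positivity
  set m := ex (piWeight (Fin n) w) d with hm
  have hA : pr (piWeight (Fin n) w) S ≤ Real.exp (-l * m + n * (l ^ 2 / 2)) := by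
    have := ex_exp_le_of_lipschitz hw (-l) n d hdl
    rw [← hm, neg_sq] at this
    refine le_trans (ex_mono hp fun ω => ?_) this
    split_ifs with h
    · simp [hd0 ω h]
    · exact Real.exp_nonneg _
  have hB : Real.exp (l * r) * pr (piWeight (Fin n) w) (fun ω => ¬ HammingClose S r ω) ≤
      Real.exp (l * m + n * (l ^ 2 / 2)) := by
    refine le_trans ?_ (ex_exp_le_of_lipschitz hw l n d hdl)
    rw [pr, ← ex_const_mul]
    refine ex_mono hp fun ω => ?_
    by_cases h : HammingClose S r ω
    · simpa [h] using Real.exp_nonneg _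
    · simpa [h] using mul_le_mul_of_nonneg_left (hdr ω h) hl0
  have hC : pr (piWeight (Fin n) w) (fun ω => ¬ HammingClose S r ω) ≤
      Real.exp (-(l * r)) * Real.exp (l * m + n * (l ^ 2 / 2)) := by
    have := mul_le_mul_of_nonneg_left hB (Real.exp_nonneg (-(l * r)))
    rwa [← mul_assoc, ← Real.exp_add, neg_add_cancel, Real.exp_zero, one_mul] at this
  refine (mul_le_mul hA hC (pr_nonneg hp _) (Real.exp_nonneg _)).trans (le_of_eq ?_)
  rw [← Real.exp_add, ← Real.exp_add]
  congr 1
  have : (n : ℝ) ≠ 0 := by positivity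
  rw [hl]; field_simp; ring

end Concentration

/-! ### Cyclic permutations and the second moment of the number of Hamilton cycles -/

section SecondMoment

open Equiv

variable {Ω V : Type*} [Fintype Ω]

/-- A Paley–Zygmund inequality. Off the event `f` is below `m / 2`; on it, `f ≤ (t/2) f² + 1/(2t)`
replaces Cauchy–Schwarz. The choice of `t` makes the quadratic term at most `m / 4`, leaving `m / 4`
for the event. -/
lemma le_pr_half_mean {w : Ω → ℝ} (hw : IsProbWeight w) {f : Ω → ℝ}
    {m M : ℝ} (hm : ex w f = m) (hm0 : 0 < m) (hM : 0 < M)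
    (h2 : ex w (fun x => f x ^ 2) ≤ M * m ^ 2) :
    1 / (4 * M) ≤ pr w (fun x => m / 2 ≤ f x) := by
  classical
  set t : ℝ := 1 / (2 * M * m) with ht
  have ht0 : 0 < t := by positivity
  have h : m ≤ m / 2 + (t / 2 * (M * m ^ 2) + 1 / (2 * t) * pr w (fun x => m / 2 ≤ f x)) := by
    calc m = ex w f := hm.symm
      _ ≤ ex w (fun x => m / 2 + (t / 2 * f x ^ 2 +
            1 / (2 * t) * if m / 2 ≤ f x then 1 else 0)) := by
          refine ex_mono hw fun x => ?_
          split_ifs with hx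
          · have : f x ≤ t / 2 * f x ^ 2 + 1 / (2 * t) * 1 := by
              have : 0 ≤ (t * f x - 1) ^ 2 / (2 * t) := by positivity
              have e : (t * f x - 1) ^ 2 / (2 * t) = t / 2 * f x ^ 2 + 1 / (2 * t) * 1 - f x := by
                field_simp; ring
              linarith
            linarith
          · have : 0 ≤ t / 2 * f x ^ 2 := by positivity
            linarith [not_le.1 hx]
      _ = m / 2 + (t / 2 * ex w (fun x => f x ^ 2) +
            1 / (2 * t) * pr w (fun x => m / 2 ≤ f x)) := by
          rw [ex_add, ex_const hw, ex_add, ex_const_mul, ex_const_mul]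
          unfold pr
          congr!
      _ ≤ _ := by gcongr
  have e1 : t / 2 * (M * m ^ 2) = m / 4 := by rw [ht]; field_simp; ring
  have e2 : 1 / (2 * t) = M * m := by rw [ht]; field_simp
  rw [e1, e2] at h
  rw [div_le_iff₀ (by positivity)]
  have : m * 1 ≤ m * (pr w (fun x => m / 2 ≤ f x) * (4 * M)) := by linarith
  exact le_of_mul_le_mul_left this hm0

/-- A permutation consisting of a single cycle through all points. -/
def FullCycle (π : Perm V) : Prop := ∀ x y, π.SameCycle x y

variable [Fintype V]

lemma FullCycle.apply_ne {π : Equiv.Perm V} (h : FullCycle π) (hV : 2 ≤ Fintype.card V) (x : V) :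
    π x ≠ x := by
  intro hx
  obtain ⟨y, hy⟩ := Fintype.exists_ne_of_one_lt_card (by omega) x
  exact hy ((h x y).eq_of_left hx).symm

variable [DecidableEq V]

lemma FullCycle.cycleType_eq {π : Perm V} (h : FullCycle π) (hV : 2 ≤ Fintype.card V) :
    π.cycleType = {Fintype.card V} := by
  have hne : ∀ x, π x ≠ x := h.apply_ne hV
  have hs : π.support = Finset.univ := by ext x; simp [hne]
  obtain ⟨x⟩ : Nonempty V := Fintype.card_pos_iff.1 (by omega)
  have hc : π.IsCycle := ⟨x, hne x, fun y _ => h x y⟩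
  rw [hc.cycleType, hs, Finset.card_univ]

lemma fullCycle_of_cycleType {π : Perm V} (h : π.cycleType = {Fintype.card V}) :
    FullCycle π := by
  have hc : π.IsCycle := by
    rw [← Perm.card_cycleType_eq_one, h]; simp
  have hs : π.support = Finset.univ := by
    rw [← Finset.card_eq_iff_eq_univ, ← Perm.sum_cycleType, h]; simp
  intro x y
  have hx : ∀ x, π x ≠ x := fun x => by rw [← Perm.mem_support, hs]; simp
  exact hc.sameCycle (hx x) (hx y)

open Classical in
variable (V) in
/-- All cyclic permutations of `V`. -/
noncomputable def fullCycles : Finset (Perm V) := Finset.univ.filter FullCycle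

open Classical in
/-- The cyclic permutations all of whose arcs lie in `ω`. -/
noncomputable def cyclesIn (ω : V × V → Bool) : Finset (Perm V) :=
  (fullCycles V).filter fun π => ∀ x, ω (x, π x) = true

lemma mem_cyclesIn {ω : V × V → Bool} {π : Perm V} :
    π ∈ cyclesIn ω ↔ FullCycle π ∧ ∀ x, ω (x, π x) = true := by
  simp [cyclesIn, fullCycles]

lemma cyclesIn_mono {ω ω' : V × V → Bool} (h : ω ≤ ω') : cyclesIn ω ⊆ cyclesIn ω' := by
  intro π
  rw [mem_cyclesIn, mem_cyclesIn]
  exact fun hπ => ⟨hπ.1, fun x => h _ (hπ.2 x)⟩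

lemma factorial_le_card_mul_card_fullCycles (hV : 2 ≤ Fintype.card V) :
    (Fintype.card V).factorial ≤ Fintype.card V * (fullCycles V).card := by
  have h := Perm.card_of_cycleType_singleton (α := V) hV le_rfl
  rw [Nat.choose_self, mul_one] at h
  rw [← Nat.mul_factorial_pred (by omega : Fintype.card V ≠ 0), ← h]
  refine Nat.mul_le_mul_left _ (Finset.card_le_card fun π hπ => ?_)
  simp only [Finset.mem_filter, Finset.mem_univ, true_and] at hπ
  simp [fullCycles, fullCycle_of_cycleType hπ]

lemma card_fullCycles_le : (fullCycles V).card ≤ (Fintype.card V).factorial := by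
  rw [← Fintype.card_perm]
  exact Finset.card_le_univ _

/-- If `τ` agrees with `π` on `F`, then `π⁻¹ τ` fixes `F` pointwise, so it is a permutation of the
complement. -/
lemma card_perm_agree_le (π : Perm V) (F : Finset V) :
    (Finset.univ.filter fun τ : Perm V => ∀ x ∈ F, τ x = π x).card ≤
      (Fintype.card V - F.card).factorial := by
  have h : Fintype.card {f : Perm V // ∀ a, ¬ (a ∉ F) → f a = a} =
      (Fintype.card V - F.card).factorial := by
    rw [← Fintype.card_congr (Perm.subtypeEquivSubtypePerm (fun x => x ∉ F)), Fintype.card_perm]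
    congr 1
    rw [Fintype.card_subtype_compl]; simp
  rw [← h, Fintype.card_subtype]
  refine Finset.card_le_card_of_injOn (fun τ => π⁻¹ * τ) ?_ ?_
  · intro τ hτ
    simp only [Finset.coe_filter, Finset.mem_univ, true_and, Set.mem_ofPred_eq, not_not] at hτ ⊢
    intro a ha
    simp [hτ a ha]
  · intro τ _ τ' _ h
    exact mul_left_cancel h

/-- The arcs of a permutation. -/
def arcs (π : Perm V) : Finset (V × V) := Finset.univ.image fun x => (x, π x)

lemma card_arcs (π : Perm V) : (arcs π).card = Fintype.card V := by
  rw [arcs, Finset.card_image_of_injective _ (fun x y h => (Prod.ext_iff.1 h).1), Finset.card_univ]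

lemma card_arcs_union (π τ : Perm V) :
    (arcs π ∪ arcs τ).card + (Finset.univ.filter fun x => τ x = π x).card =
      2 * Fintype.card V := by
  have h : (arcs π ∩ arcs τ).card = (Finset.univ.filter fun x => τ x = π x).card := by
    have : arcs π ∩ arcs τ = (Finset.univ.filter fun x => τ x = π x).image fun x => (x, π x) := by
      ext ⟨x, y⟩
      simp only [arcs, Finset.mem_inter, Finset.mem_image, Finset.mem_univ, true_and,
        Finset.mem_filter, Prod.mk.injEq]
      constructor
      · rintro ⟨⟨a, rfl, rfl⟩, ⟨b, rfl, hb⟩⟩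
        exact ⟨_, hb, rfl, rfl⟩
      · rintro ⟨a, ha, rfl, rfl⟩
        exact ⟨⟨_, rfl, rfl⟩, ⟨_, rfl, ha⟩⟩
    rw [this, Finset.card_image_of_injective _ (fun x y h => (Prod.ext_iff.1 h).1)]
  rw [← h, Finset.card_union_add_card_inter, card_arcs, card_arcs, two_mul]

lemma ex_card_cyclesIn (q : ℝ) :
    ex (piWeight (V × V) (bern q)) (fun ω => ((cyclesIn ω).card : ℝ)) =
      (fullCycles V).card * q ^ Fintype.card V := by
  classical
  have h : ∀ ω : V × V → Bool, ((cyclesIn ω).card : ℝ) =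
      ∑ π ∈ fullCycles V, if ∀ e ∈ arcs π, ω e = true then (1 : ℝ) else 0 := by
    intro ω
    rw [cyclesIn, Finset.card_filter]
    push_cast
    refine Finset.sum_congr rfl fun π _ => ?_
    simp [arcs]
  simp_rw [h]
  rw [ex_sum]
  have h2 : ∀ π ∈ fullCycles V, ex (piWeight (V × V) (bern q))
      (fun ω => if ∀ e ∈ arcs π, ω e = true then (1 : ℝ) else 0) = q ^ Fintype.card V := by
    intro π _
    rw [← card_arcs π, ← pr_bern_forall_true (arcs π)]
    unfold pr; congr!
  rw [Finset.sum_congr rfl h2]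
  simp

lemma ex_card_cyclesIn_sq (q : ℝ) :
    ex (piWeight (V × V) (bern q)) (fun ω => ((cyclesIn ω).card : ℝ) ^ 2) =
      ∑ π ∈ fullCycles V, ∑ τ ∈ fullCycles V, q ^ (arcs π ∪ arcs τ).card := by
  classical
  have h : ∀ ω : V × V → Bool, ((cyclesIn ω).card : ℝ) ^ 2 =
      ∑ π ∈ fullCycles V, ∑ τ ∈ fullCycles V,
        if ∀ e ∈ arcs π ∪ arcs τ, ω e = true then (1 : ℝ) else 0 := by
    intro ω
    rw [cyclesIn, Finset.card_filter]
    push_cast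
    rw [sq, Finset.sum_mul_sum]
    refine Finset.sum_congr rfl fun π _ => Finset.sum_congr rfl fun τ _ => ?_
    have : (∀ e ∈ arcs π ∪ arcs τ, ω e = true) ↔
        (∀ x, ω (x, π x) = true) ∧ ∀ x, ω (x, τ x) = true := by
      simp only [arcs, Finset.mem_union, Finset.mem_image, Finset.mem_univ, true_and]
      constructor
      · intro h
        exact ⟨fun x => h _ (Or.inl ⟨x, rfl⟩), fun x => h _ (Or.inr ⟨x, rfl⟩)⟩
      · rintro ⟨h1, h2⟩ e (⟨x, rfl⟩ | ⟨x, rfl⟩)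
        exacts [h1 x, h2 x]
    simp only [this, ite_and]
    split_ifs <;> simp
  simp_rw [h]
  rw [ex_sum]
  refine Finset.sum_congr rfl fun π _ => ?_
  rw [ex_sum]
  refine Finset.sum_congr rfl fun τ _ => ?_
  rw [← pr_bern_forall_true]
  unfold pr; congr!

/-- Writing `q⁻¹ = c + 1` expands the power over the subsets `F` of the agreement set. After
exchanging sums, the `F` of size `j` contribute at most `choose n j * (n - j)! * c^j = n! c^j / j!`,
a partial exponential series. -/
lemma sum_inv_pow_agree_le {q : ℝ} (hq : 0 < q) (hq1 : q ≤ 1) (π : Perm V) :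
    ∑ τ ∈ fullCycles V, q⁻¹ ^ (Finset.univ.filter fun x => τ x = π x).card ≤
      (Fintype.card V).factorial * Real.exp q⁻¹ := by
  classical
  set n := Fintype.card V with hn
  set c := q⁻¹ - 1 with hc
  have hc0 : 0 ≤ c := by rw [hc, sub_nonneg]; exact (one_le_inv₀ hq).2 hq1
  have hexp : ∀ A : Finset V, q⁻¹ ^ A.card =
      ∑ F : Finset V, if F ⊆ A then c ^ F.card else 0 := by
    intro A
    have h1 := Finset.sum_pow_mul_eq_add_pow c 1 A
    rw [show c + 1 = q⁻¹ by rw [hc]; ring] at h1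
    rw [← h1, ← Finset.sum_filter]
    simp only [one_pow, mul_one]
    exact Finset.sum_congr (by ext; simp) fun _ _ => rfl
  calc ∑ τ ∈ fullCycles V, q⁻¹ ^ (Finset.univ.filter fun x => τ x = π x).card
      ≤ ∑ τ : Perm V, q⁻¹ ^ (Finset.univ.filter fun x => τ x = π x).card :=
        Finset.sum_le_sum_of_subset_of_nonneg (Finset.subset_univ _)
          (fun _ _ _ => by positivity)
    _ = ∑ F : Finset V, c ^ F.card *
          (Finset.univ.filter fun τ : Perm V => ∀ x ∈ F, τ x = π x).card := by
        simp_rw [hexp]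
        rw [Finset.sum_comm]
        refine Finset.sum_congr rfl fun F _ => ?_
        rw [Finset.card_filter]
        push_cast
        rw [Finset.mul_sum]
        refine Finset.sum_congr rfl fun τ _ => ?_
        simp [Finset.subset_iff]
    _ ≤ ∑ F ∈ (Finset.univ : Finset V).powerset, c ^ F.card * ((n - F.card).factorial : ℝ) := by
        rw [Finset.powerset_univ]
        gcongr with F
        exact card_perm_agree_le π F
    _ = ∑ j ∈ Finset.range (n + 1), (n.factorial : ℝ) * (c ^ j / j.factorial) := by
        rw [Finset.sum_powerset_apply_card (fun j => c ^ j * ((n - j).factorial : ℝ)),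
          Finset.card_univ]
        refine Finset.sum_congr rfl fun j hj => ?_
        have hj' : j ≤ n := by simpa [Nat.lt_succ_iff] using hj
        have := Nat.choose_mul_factorial_mul_factorial hj'
        rw [nsmul_eq_mul, ← this]
        push_cast
        field_simp
        rw [← hn]; ring
    _ ≤ n.factorial * Real.exp q⁻¹ := by
        rw [← Finset.mul_sum]
        gcongr
        exact (Real.sum_le_exp_of_nonneg hc0 _).trans (Real.exp_le_exp.2 (by rw [hc]; linarith))

/-- With probability at least `exp (-o(n))` there are as many Hamilton cycles as expected. -/
lemma le_pr_card_cyclesIn_ge {q : ℝ} (hq : 0 < q) (hq1 : q ≤ 1) (hV : 2 ≤ Fintype.card V) :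
    1 / (4 * (Fintype.card V * Real.exp q⁻¹)) ≤
      pr (piWeight (V × V) (bern q)) (fun ω =>
        (fullCycles V).card * q ^ Fintype.card V / 2 ≤ ((cyclesIn ω).card : ℝ)) := by
  set n := Fintype.card V with hn
  have hn0 : (0 : ℝ) < n := by have : 0 < n := by omega
                               exact_mod_cast this
  have hH : (n.factorial : ℝ) ≤ n * (fullCycles V).card := by
    exact_mod_cast factorial_le_card_mul_card_fullCycles hV
  have hHpos : (0 : ℝ) < (fullCycles V).card := by
    have : (0 : ℝ) < n.factorial := by positivity
    exact pos_of_mul_pos_right (this.trans_le hH) hn0.le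
  refine le_pr_half_mean (isProbWeight_bern hq.le hq1).pi
    (ex_card_cyclesIn q) (by positivity) (by positivity) ?_
  rw [ex_card_cyclesIn_sq]
  have h1 : ∀ π ∈ fullCycles V, ∑ τ ∈ fullCycles V, q ^ (arcs π ∪ arcs τ).card ≤
      q ^ (2 * n) * (n * (fullCycles V).card * Real.exp q⁻¹) := by
    intro π _
    have h2 : ∀ τ, q ^ (arcs π ∪ arcs τ).card =
        q ^ (2 * n) * q⁻¹ ^ (Finset.univ.filter fun x => τ x = π x).card := by
      intro τ
      rw [hn, ← card_arcs_union π τ, pow_add, mul_assoc, ← mul_pow, mul_inv_cancel₀ hq.ne',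
        one_pow, mul_one]
    simp_rw [h2, ← Finset.mul_sum]
    gcongr
    exact (sum_inv_pow_agree_le hq hq1 π).trans (by gcongr)
  refine (Finset.sum_le_sum h1).trans (le_of_eq ?_)
  rw [Finset.sum_const, nsmul_eq_mul]
  ring

end SecondMoment

/-! ### Rotations of longest paths in expanding graphs -/

section Rotation

variable {V : Type*} {G : V → V → Prop}

/-- `l` lists the vertices of a path of `G`. -/
def IsListPath (G : V → V → Prop) (l : List V) : Prop := l.Nodup ∧ l.IsChain G

/-- `u` and `v` are consecutive, in some order, in the list `l`. -/
def Consec (l : List V) (u v : V) : Prop := ¬ l.IsChain fun a b => s(a, b) ≠ s(u, v)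

lemma consec_append {l₁ l₂ : List V} {u v : V} :
    Consec (l₁ ++ l₂) u v ↔ Consec l₁ u v ∨ Consec l₂ u v ∨
      ∃ x ∈ l₁.getLast?, ∃ y ∈ l₂.head?, s(x, y) = s(u, v) := by
  unfold Consec
  rw [List.isChain_append]
  simp only [not_and_or, not_forall, not_not, exists_prop]

lemma consec_reverse {l : List V} {u v : V} : Consec l.reverse u v ↔ Consec l u v := by
  unfold Consec
  rw [List.isChain_reverse]
  simp only [Sym2.eq_swap]

lemma Consec.eq_formPerm [DecidableEq V] {l : List V} (hl : l.Nodup) {u v : V}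
    (h : Consec l u v) : l.formPerm u = v ∨ l.formPerm.symm u = v := by
  unfold Consec at h
  rw [List.isChain_iff_getElem] at h
  push Not at h
  obtain ⟨i, hi, h⟩ := h
  have h1 := List.formPerm_apply_lt_getElem l hl i hi
  rcases Sym2.eq_iff.1 h with ⟨h2, h3⟩ | ⟨h2, h3⟩
  · left; rw [← h2, ← h3, h1]
  · right; rw [Equiv.symm_apply_eq, ← h2, ← h3, h1]

/-- The paths obtained from `P` by rotations at the head. -/
inductive Rotation (G : V → V → Prop) (P : List V) : List V → Prop
  | refl : Rotation G P P
  | step {x y : V} {l₁ l₂ : List V} : Rotation G P ((x :: l₁) ++ (y :: l₂)) → G x y →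
      Rotation G P ((x :: l₁).reverse ++ (y :: l₂))

lemma Rotation.perm {P Q : List V} (h : Rotation G P Q) : Q.Perm P := by
  induction h with
  | refl => exact List.Perm.refl _
  | step _ _ ih => exact ((List.reverse_perm _).append_right _).trans ih

lemma Rotation.getLast? {P Q : List V} (h : Rotation G P Q) : Q.getLast? = P.getLast? := by
  induction h with
  | refl => rfl
  | step _ _ ih =>
    rw [← ih, List.getLast?_append_of_ne_nil _ (by simp), List.getLast?_append_of_ne_nil _ (by simp)]

lemma Rotation.isListPath (hG : ∀ ⦃x y⦄, G x y → G y x) {P Q : List V} (h : Rotation G P Q)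
    (hP : IsListPath G P) : IsListPath G Q := by
  refine ⟨h.perm.nodup_iff.2 hP.1, ?_⟩
  induction h with
  | refl => exact hP.2
  | @step x y l₁ l₂ _ hxy ih =>
    rw [List.isChain_append] at ih ⊢
    refine ⟨?_, ih.2.1, ?_⟩
    · rw [List.isChain_reverse]
      exact ih.1.imp fun a b hab => hG hab
    · intro a ha b hb
      simp only [List.getLast?_reverse, List.head?_cons, Option.mem_def, Option.some.injEq]
        at ha hb
      rw [← ha, ← hb]; exact hxy

/-- The endpoints reachable by rotations. -/
def endpoints (G : V → V → Prop) (P : List V) : Set V := {x | ∃ l, Rotation G P (x :: l)}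

lemma Rotation.head_mem {P Q : List V} (h : Rotation G P Q) {w : V} (hw : Q.head? = some w) :
    w ∈ endpoints G P := by
  cases Q with
  | nil => simp at hw
  | cons a l =>
    simp only [List.head?_cons, Option.some.injEq] at hw
    exact ⟨l, hw ▸ h⟩

/-- A rotation creates one adjacency, between the old endpoint `x` and the pivot `z`. The case `y =
x` is excluded because `y` is not an endpoint. If `y = z`, then the vertex before `z` becomes an
endpoint, and it was adjacent to `y` in `P` by induction, contrary to `hn`. -/
lemma Rotation.consec {P Q : List V} (h : Rotation G P Q) {y : V} (hy : y ∉ endpoints G P)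
    (hn : ∀ u ∈ endpoints G P, ¬ Consec P u y) {u : V} (hu : Consec Q u y) : Consec P u y := by
  induction h generalizing u with
  | refl => exact hu
  | @step x z l₁ l₂ hQ hxz ih =>
    have hx : x ∈ endpoints G P := ⟨_, hQ⟩
    rw [consec_append, consec_reverse] at hu
    rcases hu with hu | hu | ⟨a, ha, b, hb, hab⟩
    · exact ih (consec_append.2 (Or.inl hu))
    · exact ih (consec_append.2 (Or.inr (Or.inl hu)))
    · exfalso
      simp only [List.getLast?_reverse, List.head?_cons, Option.mem_def, Option.some.injEq]
        at ha hb
      subst ha hb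
      rcases Sym2.eq_iff.1 hab with ⟨h1, h2⟩ | ⟨h1, h2⟩
      · subst h2
        have hlast : (x :: l₁).getLast? = some ((x :: l₁).getLast (by simp)) :=
          List.getLast?_eq_getLast_of_ne_nil _
        have hw : (x :: l₁).getLast (by simp) ∈ endpoints G P := by
          refine (hQ.step hxz).head_mem ?_
          rw [List.head?_append, List.head?_reverse, hlast]; rfl
        exact hn _ hw (ih (consec_append.2 (Or.inr (Or.inr ⟨_, hlast, z, rfl, rfl⟩))))
      · exact hy (h1 ▸ hx)

/-- A neighbour of a reachable endpoint lies next to a reachable endpoint on the path. -/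
lemma exists_consec_of_adj {P : List V} {x y : V} (hx : x ∈ endpoints G P) (hxy : G x y)
    (hyP : y ∈ P) (hy : y ∉ endpoints G P) : ∃ u ∈ endpoints G P, Consec P u y := by
  by_contra hn
  push Not at hn
  obtain ⟨l, hl⟩ := hx
  have hyl : y ∈ x :: l := hl.perm.mem_iff.2 hyP
  have hne : y ≠ x := fun h => hy (h ▸ ⟨l, hl⟩)
  obtain ⟨l₁, l₂, rfl⟩ := List.append_of_mem ((List.mem_cons.1 hyl).resolve_left hne)
  have hl' : Rotation G P ((x :: l₁) ++ (y :: l₂)) := hl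
  have hlast : (x :: l₁).getLast? = some ((x :: l₁).getLast (by simp)) :=
    List.getLast?_eq_getLast_of_ne_nil _
  have hw : (x :: l₁).getLast (by simp) ∈ endpoints G P := by
    refine (hl'.step hxy).head_mem ?_
    rw [List.head?_append, List.head?_reverse, hlast]; rfl
  exact hn _ hw (hl'.consec hy hn (consec_append.2 (Or.inr (Or.inr ⟨_, hlast, y, rfl, rfl⟩))))

variable [Fintype V]

/-- Every set of at most a quarter of the vertices more than doubles its size outside itself. -/
def Expands (G : V → V → Prop) : Prop :=
  ∀ S W : Finset V, S.Nonempty → 4 * S.card ≤ Fintype.card V → S ⊆ W → W.card ≤ 3 * S.card →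
    ∃ x ∈ S, ∃ y ∉ W, G x y

lemma Expands.mono {G' : V → V → Prop} (h : Expands G) (hG : ∀ x y, G x y → G' x y) :
    Expands G' := by
  intro S W h1 h2 h3 h4
  obtain ⟨x, hx, y, hy, hxy⟩ := h S W h1 h2 h3 h4
  exact ⟨x, hx, y, hy, hG x y hxy⟩

open Classical in
/-- The endpoints reachable by rotations, as a finite set. -/
noncomputable def endpointFinset (G : V → V → Prop) (P : List V) : Finset V :=
  Finset.univ.filter fun x => x ∈ endpoints G P

lemma mem_endpointFinset {P : List V} {x : V} :
    x ∈ endpointFinset G P ↔ x ∈ endpoints G P := by simp [endpointFinset]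

/-- A longest path of an expanding graph has many endpoints reachable by rotations. -/
lemma card_lt_four_mul_card_endpointFinset (hG : ∀ ⦃x y⦄, G x y → G y x) (hE : Expands G)
    {P : List V} (hP : IsListPath G P) (hne : P ≠ [])
    (hmax : ∀ l, IsListPath G l → l.length ≠ P.length + 1) :
    Fintype.card V < 4 * (endpointFinset G P).card := by
  classical
  by_contra hlt
  push Not at hlt
  set E := endpointFinset G P with hEdef
  set W := E ∪ (E.image P.formPerm ∪ E.image P.formPerm.symm) with hW
  have hWc : W.card ≤ 3 * E.card := by
    have h1 := Finset.card_union_le E (E.image P.formPerm ∪ E.image P.formPerm.symm)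
    rw [← hW] at h1
    have h2 := Finset.card_union_le (E.image P.formPerm) (E.image P.formPerm.symm)
    have h3 : (E.image P.formPerm).card ≤ E.card := Finset.card_image_le
    have h4 : (E.image P.formPerm.symm).card ≤ E.card := Finset.card_image_le
    omega
  have hEne : E.Nonempty := by
    obtain ⟨a, l, rfl⟩ := List.exists_cons_of_ne_nil hne
    exact ⟨a, mem_endpointFinset.2 ⟨l, Rotation.refl⟩⟩
  obtain ⟨x, hx, y, hy, hxy⟩ := hE E W hEne hlt Finset.subset_union_left hWc
  have hxE := mem_endpointFinset.1 hx
  simp only [hW, Finset.mem_union, not_or] at hy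
  have hyE : y ∉ endpoints G P := fun h => hy.1 (mem_endpointFinset.2 h)
  have hyP : y ∈ P := by
    by_contra hyP
    obtain ⟨l, hl⟩ := hxE
    have hp := hl.isListPath hG hP
    refine hmax (y :: x :: l) ⟨?_, ?_⟩ ?_
    · exact List.nodup_cons.2 ⟨fun h => hyP (hl.perm.mem_iff.1 h), hp.1⟩
    · exact List.isChain_cons_cons.2 ⟨hG hxy, hp.2⟩
    · rw [List.length_cons, hl.perm.length_eq]
  obtain ⟨u, hu, hc⟩ := exists_consec_of_adj hxE hxy hyP hyE
  rcases hc.eq_formPerm hP.1 with h | h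
  · exact hy.2.1 (Finset.mem_image.2 ⟨u, mem_endpointFinset.2 hu, h⟩)
  · exact hy.2.2 (Finset.mem_image.2 ⟨u, mem_endpointFinset.2 hu, h⟩)

/-- Expansion implies connectivity. With `m = ⌊n/4⌋ ≥ 1`, a set of at most `3m` vertices expands,
either itself or through a subset of size `m`; if `U` is larger, its complement has at most `3m`
vertices. -/
lemma Expands.exists_adj_compl (hG : ∀ ⦃x y⦄, G x y → G y x) (hE : Expands G)
    (hV : 4 ≤ Fintype.card V)
    (U : Finset V) (hU : U.Nonempty) (hU' : ∃ x, x ∉ U) : ∃ x ∈ U, ∃ y ∉ U, G x y := by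
  classical
  have key : ∀ U : Finset V, U.Nonempty → U.card ≤ 3 * (Fintype.card V / 4) →
      ∃ x ∈ U, ∃ y ∉ U, G x y := by
    intro U hU hc
    by_cases h4 : 4 * U.card ≤ Fintype.card V
    · exact hE U U hU h4 subset_rfl (by omega)
    · obtain ⟨S, hSU, hS⟩ := Finset.exists_subset_card_eq
        (show Fintype.card V / 4 ≤ U.card by omega)
      obtain ⟨x, hx, y, hy, hxy⟩ := hE S U (Finset.card_pos.1 (by omega)) (by omega) hSU
        (by omega)
      exact ⟨x, hSU hx, y, hy, hxy⟩
  by_cases hc : U.card ≤ 3 * (Fintype.card V / 4)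
  · exact key U hU hc
  · have h1 := Finset.card_compl U
    obtain ⟨a, ha⟩ := hU'
    obtain ⟨x, hx, y, hy, hxy⟩ := key Uᶜ ⟨a, by simpa using ha⟩ (by omega)
    exact ⟨y, by simpa using hy, x, by simpa using hx, hG hxy⟩

/-- `G` has a Hamilton cycle, given as a list of vertices. -/
def HasHamiltonList (G : V → V → Prop) : Prop :=
  ∃ l : List V, IsListPath G l ∧ l.length = Fintype.card V ∧
    ∃ x ∈ l.getLast?, ∃ y ∈ l.head?, G x y

/-- `G` is Hamiltonian or has a path with `k` vertices. -/
def HasLongPath (G : V → V → Prop) (k : ℕ) : Prop :=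
  HasHamiltonList G ∨ ∃ l, IsListPath G l ∧ l.length = k

/-- Closing a path on `k` vertices yields a Hamilton cycle or a longer path. -/
lemma hasLongPath_succ_of_closed (hG : ∀ ⦃x y⦄, G x y → G y x) (hE : Expands G)
    (hV : 4 ≤ Fintype.card V)
    {l : List V} (hl : IsListPath G l) {x y : V} (hx : l.getLast? = some x)
    (hy : l.head? = some y) (hxy : G x y) : HasLongPath G (l.length + 1) := by
  classical
  have hlen : l.toFinset.card = l.length := List.toFinset_card_of_nodup hl.1
  by_cases hk : l.length = Fintype.card V
  · exact Or.inl ⟨l, hl, hk, x, hx, y, hy, hxy⟩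
  right
  have hle : l.length ≤ Fintype.card V := hlen ▸ Finset.card_le_univ _
  have hne : ∃ z, z ∉ l.toFinset := by
    by_contra h
    push Not at h
    exact hk (by rw [← hlen, Finset.eq_univ_iff_forall.2 h, Finset.card_univ])
  have hyl : y ∈ l := List.mem_of_mem_head? hy
  -- The closed path misses some vertex, so an edge leaves it; cutting the cycle open at `u` and
  -- prepending `v` gives a longer path.
  obtain ⟨u, hu, v, hv, huv⟩ := hE.exists_adj_compl hG hV l.toFinset
    ⟨y, by simpa using hyl⟩ hne
  rw [List.mem_toFinset] at hu hv
  obtain ⟨a, b, rfl⟩ := List.append_of_mem hu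
  refine ⟨v :: ((u :: b) ++ a), ⟨?_, ?_⟩, ?_⟩
  · rw [List.nodup_cons]
    refine ⟨fun h => hv ?_, ?_⟩
    · simpa [or_comm, or_assoc, or_left_comm] using h
    · exact (List.perm_append_comm.nodup_iff).1 hl.1
  · have hc := hl.2
    rw [List.isChain_append] at hc
    have : ((u :: b) ++ a).IsChain G := by
      rw [List.isChain_append]
      refine ⟨hc.2.1, hc.1, fun c hc d hd => ?_⟩
      have h1 : c = x := by
        rw [List.getLast?_append_of_ne_nil _ (by simp)] at hx
        exact Option.some.inj ((Option.mem_def.1 hc).symm.trans hx)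
      have h2 : d = y := by
        rw [List.head?_append, Option.mem_def.1 hd] at hy
        simpa using hy
      rw [h1, h2]; exact hxy
    exact List.isChain_cons_cons.2 ⟨hG huv, this⟩
  · simp; omega

/-- A non-Hamiltonian expanding graph has quadratically many pairs whose addition creates a longer
path or a Hamilton cycle. -/
lemma Expands.exists_boosters (hG : ∀ ⦃x y⦄, G x y → G y x) (hE : Expands G)
    (hV : 4 ≤ Fintype.card V)
    {k : ℕ} (hk : 1 ≤ k) (h : HasLongPath G k) (h' : ¬ HasLongPath G (k + 1)) :
    ∃ B : Finset (V × V), Fintype.card V ^ 2 ≤ 16 * B.card ∧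
      ∀ e ∈ B, ∀ G' : V → V → Prop, (∀ ⦃x y⦄, G' x y → G' y x) →
        (∀ x y, G x y → G' x y) → G' e.1 e.2 → HasLongPath G' (k + 1) := by
  classical
  have hham : ¬ HasHamiltonList G := fun hh => h' (Or.inl hh)
  have hmax : ∀ l, IsListPath G l → l.length ≠ k + 1 := fun l hl hl' => h' (Or.inr ⟨l, hl, hl'⟩)
  obtain ⟨P, hP, rfl⟩ := h.resolve_left hham
  set B : Finset (V × V) := Finset.univ.filter fun e =>
    ∃ l, IsListPath G l ∧ l.length = P.length ∧ l.getLast? = some e.1 ∧ l.head? = some e.2 with hB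
  refine ⟨B, ?_, ?_⟩
  · set E := endpointFinset G P with hEd
    have hE1 : Fintype.card V < 4 * E.card :=
      card_lt_four_mul_card_endpointFinset hG hE hP (List.ne_nil_of_length_pos hk) hmax
    -- Rotation is applied twice: once for more than `n / 4` first ends `x`, then, with `x` kept as
    -- the fixed end of the reversed path, for more than `n / 4` other ends.
    have hfib : ∀ x ∈ E, Fintype.card V ≤ 4 * (B.filter fun e => e.1 = x).card := by
      intro x hx
      obtain ⟨l, hl⟩ := mem_endpointFinset.1 hx
      have hQ := hl.isListPath hG hP
      have hQr : IsListPath G (x :: l).reverse := by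
        refine ⟨List.nodup_reverse.2 hQ.1, ?_⟩
        rw [List.isChain_reverse]
        exact hQ.2.imp fun a b hab => hG hab
      have hlen : (x :: l).reverse.length = P.length := by
        rw [List.length_reverse, hl.perm.length_eq]
      have h1 := card_lt_four_mul_card_endpointFinset hG hE hQr (by simp)
        (by rw [hlen]; exact hmax)
      have h2 : (endpointFinset G (x :: l).reverse).card ≤ (B.filter fun e => e.1 = x).card := by
        refine Finset.card_le_card_of_injOn (fun y => (x, y)) ?_
          (fun a _ b _ hab => (Prod.ext_iff.1 hab).2)
        intro y hy
        obtain ⟨m, hm⟩ := mem_endpointFinset.1 hy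
        simp only [hB, Finset.coe_filter, Set.mem_ofPred_eq, Finset.mem_filter, Finset.mem_univ,
          true_and, and_true]
        refine ⟨y :: m, hm.isListPath hG hQr, ?_, ?_, rfl⟩
        · rw [hm.perm.length_eq, hlen]
        · rw [hm.getLast?]; simp
      omega
    have hsum : ∑ x ∈ E, (B.filter fun e => e.1 = x).card ≤ B.card := by
      rw [Finset.card_eq_sum_card_fiberwise (f := Prod.fst) (t := Finset.univ) (by simp)]
      exact Finset.sum_le_sum_of_subset (Finset.subset_univ _)
    have h2 := Finset.sum_le_sum hfib
    rw [← Finset.mul_sum, Finset.sum_const, smul_eq_mul] at h2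
    nlinarith
  · rintro ⟨x, y⟩ he G' hG' hle hxy
    simp only [hB, Finset.mem_filter, Finset.mem_univ, true_and] at he
    obtain ⟨l, hl, hlen, hx, hy⟩ := he
    rw [← hlen]
    exact hasLongPath_succ_of_closed hG' (hE.mono hle) hV ⟨hl.1, hl.2.imp hle⟩ hx hy hxy

end Rotation

/-! ### Hamiltonicity of the binomial random graph -/

section RandomGraph

variable {V : Type*}

/-- The graph whose edges are the pairs selected by `ω`. -/
def edgeRel (ω : Sym2 V → Bool) (x y : V) : Prop := ω s(x, y) = true

lemma edgeRel_symm (ω : Sym2 V → Bool) ⦃x y : V⦄ (h : edgeRel ω x y) : edgeRel ω y x := by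
  unfold edgeRel at *; rwa [Sym2.eq_swap]

lemma edgeRel_mono {ω ω' : Sym2 V → Bool} (h : ω ≤ ω') (x y : V) (hxy : edgeRel ω x y) :
    edgeRel ω' x y := h _ hxy

variable [Fintype V]

lemma HasLongPath.mono {G G' : V → V → Prop} (hG : ∀ x y, G x y → G' x y) {k : ℕ}
    (h : HasLongPath G k) : HasLongPath G' k := by
  rcases h with ⟨l, hl, h1, x, hx, y, hy, hxy⟩ | ⟨l, hl, h1⟩
  · exact Or.inl ⟨l, ⟨hl.1, hl.2.imp hG⟩, h1, x, hx, y, hy, hG _ _ hxy⟩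
  · exact Or.inr ⟨l, ⟨hl.1, hl.2.imp hG⟩, h1⟩

lemma HasLongPath.hasHamiltonList {G : V → V → Prop} (h : HasLongPath G (Fintype.card V + 1)) :
    HasHamiltonList G := by
  classical
  rcases h with h | ⟨l, hl, h1⟩
  · exact h
  · have := (List.toFinset_card_of_nodup hl.1) ▸ Finset.card_le_univ l.toFinset
    omega

variable [DecidableEq V]

lemma one_sub_pow_le_exp {q : ℝ} (hq1 : q ≤ 1) (k : ℕ) {t : ℝ} (ht : t ≤ q * k) :
    (1 - q) ^ k ≤ Real.exp (-t) := by
  calc (1 - q) ^ k ≤ Real.exp (-q) ^ k := by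
        exact pow_le_pow_left₀ (by linarith) (by linarith [Real.add_one_le_exp (-q)]) k
    _ = Real.exp (-(q * k)) := by rw [← Real.exp_nat_mul]; ring_nf
    _ ≤ _ := Real.exp_le_exp.2 (by linarith)

lemma pr_no_edges_between {q : ℝ} {S W : Finset V} (h : S ⊆ W) :
    pr (piWeight (Sym2 V) (bern q)) (fun ω => ∀ x ∈ S, ∀ y ∉ W, ¬ edgeRel ω x y) =
      (1 - q) ^ (S.card * (Fintype.card V - W.card)) := by
  set B : Finset (Sym2 V) := (S ×ˢ Wᶜ).image fun e => s(e.1, e.2) with hB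
  have hc : B.card = S.card * (Fintype.card V - W.card) := by
    rw [hB, Finset.card_image_of_injOn, Finset.card_product, Finset.card_compl]
    rintro ⟨a, b⟩ hab ⟨c, d⟩ hcd he
    simp only [Finset.coe_product, Set.mem_prod, Finset.mem_coe, Finset.mem_compl] at hab hcd
    rcases Sym2.eq_iff.1 he with ⟨h1, h2⟩ | ⟨h1, h2⟩
    · exact Prod.ext h1 h2
    · exact absurd (h (show d ∈ S by rw [← show a = d from h1]; exact hab.1)) hcd.2
  rw [← hc, ← pr_bern_forall_false]
  congr 1
  ext ω
  simp only [hB, Finset.mem_image, Finset.mem_product, Finset.mem_compl, Prod.exists, edgeRel]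
  constructor
  · rintro h _ ⟨a, b, ⟨ha, hb⟩, rfl⟩
    simpa using h a ha b hb
  · intro h x hx y hy
    simpa using h _ ⟨x, y, ⟨hx, hy⟩, rfl⟩

/-- A union bound over `|S| = s` and `W` enlarged to exactly `3s` vertices. There are at most
`n^(4s)` such pairs; each requires `s (n - 3s) ≥ s n / 4` absent edges, which has probability at
most `n^(-6s)`. -/
lemma pr_not_expands_le {q : ℝ} (hq0 : 0 ≤ q) (hq1 : q ≤ 1) (hV : 4 ≤ Fintype.card V)
    (hq : 24 * Real.log (Fintype.card V) ≤ q * Fintype.card V) :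
    pr (piWeight (Sym2 V) (bern q)) (fun ω => ¬ Expands (edgeRel ω)) ≤
      1 / (Fintype.card V : ℝ) := by
  classical
  set n := Fintype.card V with hn
  have hn0 : (0 : ℝ) < n := by have : 0 < n := by omega
                               exact_mod_cast this
  have hn1 : (1 : ℝ) ≤ n := by have : 1 ≤ n := by omega
                               exact_mod_cast this
  have hlog : 0 ≤ Real.log n := Real.log_nonneg hn1
  have hw := (isProbWeight_bern hq0 hq1).pi (ι := Sym2 V)
  let J : Finset (Finset V × Finset V) := (Finset.Icc 1 (n / 4)).biUnion fun s =>
    (Finset.powersetCard s Finset.univ ×ˢ Finset.powersetCard (3 * s) Finset.univ).filter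
      fun e => e.1 ⊆ e.2
  have h1 : ∀ ω : Sym2 V → Bool, ¬ Expands (edgeRel ω) →
      ∃ e ∈ J, ∀ x ∈ e.1, ∀ y ∉ e.2, ¬ edgeRel ω x y := by
    intro ω h
    unfold Expands at h
    push Not at h
    obtain ⟨S, W, hS, hc, hSW, hW, hno⟩ := h
    obtain ⟨W', hWW', hW'⟩ := Finset.exists_superset_card_eq hW (by omega)
    refine ⟨(S, W'), ?_, fun x hx y hy => hno x hx y (fun hyW => hy (hWW' hyW))⟩
    have := hS.card_pos
    simp only [J, Finset.mem_biUnion, Finset.mem_Icc, Finset.mem_filter, Finset.mem_product,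
      Finset.mem_powersetCard, Finset.subset_univ, true_and]
    exact ⟨S.card, ⟨by omega, by omega⟩, ⟨rfl, hW'⟩, hSW.trans hWW'⟩
  have h2 : ∀ s ∈ Finset.Icc 1 (n / 4), ∑ e ∈ (Finset.powersetCard s (Finset.univ : Finset V) ×ˢ
      Finset.powersetCard (3 * s) (Finset.univ : Finset V)).filter fun e => e.1 ⊆ e.2,
      pr (piWeight (Sym2 V) (bern q)) (fun ω => ∀ x ∈ e.1, ∀ y ∉ e.2, ¬ edgeRel ω x y) ≤
      1 / (n : ℝ) ^ 2 := by
    intro s hs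
    rw [Finset.mem_Icc] at hs
    have hs1 : (1 : ℝ) ≤ s := by exact_mod_cast hs.1
    calc _ ≤ ∑ e ∈ (Finset.powersetCard s (Finset.univ : Finset V) ×ˢ
          Finset.powersetCard (3 * s) (Finset.univ : Finset V)).filter fun e => e.1 ⊆ e.2,
          Real.exp (-(6 * s * Real.log n)) := by
          refine Finset.sum_le_sum fun e he => ?_
          simp only [Finset.mem_filter, Finset.mem_product, Finset.mem_powersetCard,
            Finset.subset_univ, true_and] at he
          rw [pr_no_edges_between he.2, he.1.1, he.1.2]
          refine one_sub_pow_le_exp hq1 _ ?_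
          have h3 : n ≤ 4 * (n - 3 * s) := by omega
          have h4 : (n : ℝ) ≤ 4 * ((n - 3 * s : ℕ) : ℝ) := by exact_mod_cast h3
          push_cast [← hn]
          have h5 : q * n ≤ q * (4 * ((n - 3 * s : ℕ) : ℝ)) := by gcongr
          have h6 : 6 * Real.log n ≤ q * ((n - 3 * s : ℕ) : ℝ) := by linarith
          have h7 := mul_le_mul_of_nonneg_left h6 (by linarith : (0 : ℝ) ≤ s)
          linarith
      _ ≤ (n : ℝ) ^ (4 * s) * Real.exp (-(6 * s * Real.log n)) := by
          rw [Finset.sum_const, nsmul_eq_mul]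
          gcongr
          have h3 : ((Finset.powersetCard s (Finset.univ : Finset V) ×ˢ
            Finset.powersetCard (3 * s) (Finset.univ : Finset V)).filter
              fun e => e.1 ⊆ e.2).card ≤ n ^ (4 * s) := by
            refine (Finset.card_filter_le _ _).trans ?_
            rw [Finset.card_product, Finset.card_powersetCard, Finset.card_powersetCard,
              Finset.card_univ, show 4 * s = s + 3 * s by ring, pow_add]
            exact Nat.mul_le_mul (Nat.choose_le_pow _ _) (Nat.choose_le_pow _ _)
          exact_mod_cast h3
      _ = Real.exp (-(2 * s * Real.log n)) := by
          have : (n : ℝ) ^ (4 * s) = Real.exp (4 * s * Real.log n) := by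
            rw [← Real.exp_log hn0, ← Real.exp_nat_mul, Real.exp_log hn0]; push_cast; ring_nf
          rw [this, ← Real.exp_add]; ring_nf
      _ ≤ Real.exp (-(2 * Real.log n)) := by
          refine Real.exp_le_exp.2 ?_
          nlinarith
      _ = 1 / (n : ℝ) ^ 2 := by
          rw [Real.exp_neg, show 2 * Real.log n = ((2 : ℕ) : ℝ) * Real.log n by norm_num,
            Real.exp_nat_mul, Real.exp_log hn0, one_div]
  calc _ ≤ pr (piWeight (Sym2 V) (bern q))
          (fun ω => ∃ e ∈ J, ∀ x ∈ e.1, ∀ y ∉ e.2, ¬ edgeRel ω x y) := pr_mono hw h1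
    _ ≤ ∑ e ∈ J, pr (piWeight (Sym2 V) (bern q))
          (fun ω => ∀ x ∈ e.1, ∀ y ∉ e.2, ¬ edgeRel ω x y) := pr_exists_le hw _ _
    _ ≤ ∑ s ∈ Finset.Icc 1 (n / 4), 1 / (n : ℝ) ^ 2 := by
        rw [Finset.sum_biUnion]
        · exact Finset.sum_le_sum h2
        · intro s _ t _ hst
          rw [Function.onFun, Finset.disjoint_left]
          intro e he he'
          simp only [Finset.mem_filter, Finset.mem_product, Finset.mem_powersetCard] at he he'
          exact hst (he.1.1.2.symm.trans he'.1.1.2)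
    _ ≤ 1 / (n : ℝ) := by
        rw [Finset.sum_const, nsmul_eq_mul, Nat.card_Icc]
        have h3 : ((n / 4 + 1 - 1 : ℕ) : ℝ) ≤ n := by
          have : n / 4 + 1 - 1 ≤ n := by omega
          exact_mod_cast this
        calc _ ≤ (n : ℝ) * (1 / (n : ℝ) ^ 2) := by gcongr
          _ = 1 / (n : ℝ) := by field_simp

/-- If the path cannot already be extended, at least `n² / 16` ordered pairs, hence `n² / 32`
unordered ones, are boosters, and the new round misses all of them with probability at most `exp (-q
n² / 32) ≤ n^(-2)`. -/
lemma pr_not_booster_le {q : ℝ} (hq0 : 0 ≤ q) (hq1 : q ≤ 1) (hV : 4 ≤ Fintype.card V)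
    (hq : 64 * Real.log (Fintype.card V) ≤ q * (Fintype.card V : ℝ) ^ 2)
    {k : ℕ} (hk : 1 ≤ k) {a : Sym2 V → Bool} (hE : Expands (edgeRel a))
    (hl : HasLongPath (edgeRel a) k) :
    pr (piWeight (Sym2 V) (bern q)) (fun b =>
      ¬ (Expands (edgeRel (a ⊔ b)) ∧ HasLongPath (edgeRel (a ⊔ b)) (k + 1))) ≤
        1 / (Fintype.card V : ℝ) ^ 2 := by
  classical
  set n := Fintype.card V with hn
  have hn0 : (0 : ℝ) < n := by have : 0 < n := by omega
                               exact_mod_cast this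
  have hw := (isProbWeight_bern hq0 hq1).pi (ι := Sym2 V)
  have hmono : ∀ b : Sym2 V → Bool, ∀ x y, edgeRel a x y → edgeRel (a ⊔ b) x y :=
    fun b => edgeRel_mono le_sup_left
  by_cases hl' : HasLongPath (edgeRel a) (k + 1)
  · have : pr (piWeight (Sym2 V) (bern q)) (fun b =>
      ¬ (Expands (edgeRel (a ⊔ b)) ∧ HasLongPath (edgeRel (a ⊔ b)) (k + 1))) = 0 := by
      simp [pr, ex, hE.mono (hmono _), hl'.mono (hmono _)]
    rw [this]; positivity
  obtain ⟨B, hB, hB'⟩ := hE.exists_boosters (edgeRel_symm a) hV hk hl hl'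
  set C : Finset (Sym2 V) := B.image fun e => s(e.1, e.2) with hC
  have hBC : B.card ≤ 2 * C.card := by
    refine Finset.card_le_mul_card_image B 2 fun c _ => ?_
    induction c using Sym2.ind with
    | _ x y =>
      refine (Finset.card_le_card (t := {(x, y), (y, x)}) ?_).trans Finset.card_le_two
      intro e he
      rw [Finset.mem_filter] at he
      rcases Sym2.eq_iff.1 he.2 with ⟨h1, h2⟩ | ⟨h1, h2⟩
      · simp [← h1, ← h2]
      · simp [← h1, ← h2]
  calc _ ≤ pr (piWeight (Sym2 V) (bern q)) (fun b => ∀ i ∈ C, b i = false) := by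
        refine pr_mono hw fun b hb => ?_
        by_contra h
        push Not at h
        obtain ⟨c, hc, hbc⟩ := h
        obtain ⟨e, he, rfl⟩ := Finset.mem_image.1 hc
        refine hb ⟨hE.mono (hmono _), hB' e he _ (edgeRel_symm _) (hmono b) ?_⟩
        have : b s(e.1, e.2) = true := by simpa using hbc
        simp [edgeRel, this]
    _ = (1 - q) ^ C.card := pr_bern_forall_false C
    _ ≤ Real.exp (-(2 * Real.log n)) := by
        refine one_sub_pow_le_exp hq1 _ ?_
        have h3 : n ^ 2 ≤ 32 * C.card := by rw [hn]; omega
        have h4 : (n : ℝ) ^ 2 ≤ 32 * C.card := by exact_mod_cast h3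
        have h5 : q * (n : ℝ) ^ 2 ≤ q * (32 * C.card) := by gcongr
        linarith
    _ = 1 / (n : ℝ) ^ 2 := by
        rw [Real.exp_neg, show 2 * Real.log n = ((2 : ℕ) : ℝ) * Real.log n by norm_num,
          Real.exp_nat_mul, Real.exp_log hn0, one_div]

/-- Sprinkling: one round of density `q₁` supplies expansion and a one-vertex path, and each of `k`
further rounds of density `q₂` adds a vertex or closes a Hamilton cycle. The parameter is the
density of the union. -/
lemma pr_not_hasLongPath_le {q₁ q₂ : ℝ} (h10 : 0 ≤ q₁) (h11 : q₁ ≤ 1) (h20 : 0 ≤ q₂)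
    (h21 : q₂ ≤ 1) (hV : 4 ≤ Fintype.card V)
    (hq₁ : 24 * Real.log (Fintype.card V) ≤ q₁ * Fintype.card V)
    (hq₂ : 64 * Real.log (Fintype.card V) ≤ q₂ * (Fintype.card V : ℝ) ^ 2) (k : ℕ) :
    pr (piWeight (Sym2 V) (bern (1 - (1 - q₁) * (1 - q₂) ^ k))) (fun ω =>
      ¬ (Expands (edgeRel ω) ∧ HasLongPath (edgeRel ω) (k + 1))) ≤
        1 / (Fintype.card V : ℝ) + k * (1 / (Fintype.card V : ℝ) ^ 2) := by
  induction k with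
  | zero =>
    have hw := (isProbWeight_bern h10 h11).pi (ι := Sym2 V)
    simp only [pow_zero, mul_one, sub_sub_cancel, Nat.cast_zero, zero_mul, add_zero, zero_add]
    refine (pr_mono hw fun ω hω => ?_).trans (pr_not_expands_le h10 h11 hV hq₁)
    intro hE
    obtain ⟨x⟩ : Nonempty V := Fintype.card_pos_iff.1 (by omega)
    exact hω ⟨hE, Or.inr ⟨[x], ⟨List.nodup_singleton x, List.IsChain.singleton x⟩, rfl⟩⟩
  | succ k ih =>
    have hle : (1 - q₁) * (1 - q₂) ^ k ≤ 1 :=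
      mul_le_one₀ (by linarith) (pow_nonneg (by linarith) _)
        (pow_le_one₀ (by linarith) (by linarith))
    have hge : 0 ≤ (1 - q₁) * (1 - q₂) ^ k :=
      mul_nonneg (by linarith) (pow_nonneg (by linarith) _)
    have hwa := (isProbWeight_bern (q := 1 - (1 - q₁) * (1 - q₂) ^ k)
      (by linarith) (by linarith)).pi (ι := Sym2 V)
    have hwb := (isProbWeight_bern h20 h21).pi (ι := Sym2 V)
    rw [← pr_bern_sup (p₁ := 1 - (1 - q₁) * (1 - q₂) ^ k) (p₂ := q₂) (by ring)]
    refine (pr_le_add_ex_pr hwa hwb (δ := 1 / (Fintype.card V : ℝ) ^ 2) (by positivity)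
      (s := fun ω => ¬ (Expands (edgeRel ω) ∧ HasLongPath (edgeRel ω) (k + 1))) ?_).trans ?_
    · intro a ha
      rw [not_not] at ha
      exact pr_not_booster_le h20 h21 hV hq₂ (by omega) ha.1 ha.2
    · push_cast; linarith

/-- The binomial random graph is Hamiltonian above the logarithmic threshold. -/
lemma pr_not_hasHamiltonList_le {q : ℝ} (hq1 : q ≤ 1) (hV : 4 ≤ Fintype.card V)
    (hq : 88 * Real.log (Fintype.card V) / Fintype.card V ≤ q) :
    pr (piWeight (Sym2 V) (bern q)) (fun ω => ¬ HasHamiltonList (edgeRel ω)) ≤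
      2 / (Fintype.card V : ℝ) := by
  set n := Fintype.card V with hn
  have hn1 : (1 : ℝ) ≤ n := by have : 1 ≤ n := by omega
                               exact_mod_cast this
  have hn0 : (0 : ℝ) < n := by linarith
  have hlog : 0 ≤ Real.log n := Real.log_nonneg hn1
  -- The expansion round and `n` booster rounds have total density at most `q₁ + n q₂`, whence `88 =
  -- 24 + 64`. After `n` rounds a path would need `n + 1` vertices, so a Hamilton cycle must have
  -- appeared.
  set q₁ : ℝ := 24 * Real.log n / n with hq₁
  set q₂ : ℝ := 64 * Real.log n / n ^ 2 with hq₂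
  have e1 : q₁ + n * q₂ = 88 * Real.log n / n := by rw [hq₁, hq₂]; field_simp; ring
  have h10 : 0 ≤ q₁ := by positivity
  have h20 : 0 ≤ q₂ := by positivity
  have hle2 : q₂ ≤ n * q₂ := le_mul_of_one_le_left h20 hn1
  have h11 : q₁ ≤ 1 := by linarith
  have h21 : q₂ ≤ 1 := by linarith
  have hbern : 1 - n * q₂ ≤ (1 - q₂) ^ n := by
    have := one_add_mul_le_pow (a := -q₂) (by linarith) n
    rw [← sub_eq_add_neg] at this
    linarith
  set Q : ℝ := 1 - (1 - q₁) * (1 - q₂) ^ n with hQ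
  have hQq : Q ≤ q := by
    have h1 := mul_le_mul_of_nonneg_left hbern (show 0 ≤ 1 - q₁ by linarith)
    have h2 : 0 ≤ q₁ * (n * q₂) := by positivity
    rw [hQ]; linarith
  have hQ0 : 0 ≤ Q := by
    have := mul_le_one₀ (show 1 - q₁ ≤ 1 by linarith) (pow_nonneg (by linarith : 0 ≤ 1 - q₂) n)
        (pow_le_one₀ (by linarith) (by linarith))
    linarith
  have hmono : Monotone fun ω : Sym2 V → Bool => HasHamiltonList (edgeRel ω) := by
    rintro ω ω' h ⟨l, hl, h1, x, hx, y, hy, hxy⟩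
    exact ⟨l, ⟨hl.1, hl.2.imp (edgeRel_mono h)⟩, h1, x, hx, y, hy, edgeRel_mono h _ _ hxy⟩
  have h1 := pr_bern_mono hQ0 hQq hq1 hmono
  have hwq := (isProbWeight_bern (hQ0.trans hQq) hq1).pi (ι := Sym2 V)
  have hwQ := (isProbWeight_bern hQ0 (hQq.trans hq1)).pi (ι := Sym2 V)
  calc _ ≤ pr (piWeight (Sym2 V) (bern Q)) (fun ω => ¬ HasHamiltonList (edgeRel ω)) := by
        rw [pr_not hwq, pr_not hwQ]; linarith
    _ ≤ pr (piWeight (Sym2 V) (bern Q)) (fun ω =>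
          ¬ (Expands (edgeRel ω) ∧ HasLongPath (edgeRel ω) (n + 1))) :=
        pr_mono hwQ fun ω hω h => hω h.2.hasHamiltonList
    _ ≤ 1 / (n : ℝ) + n * (1 / (n : ℝ) ^ 2) :=
        pr_not_hasLongPath_le h10 h11 h20 h21 hV (by rw [hq₁]; field_simp; rfl)
          (by rw [hq₂]; field_simp; rfl) n
    _ = 2 / (n : ℝ) := by field_simp; ring

end RandomGraph

/-! ### From random graphs to random digraphs -/

section Coupling

-- The nontrivial case has `T` false at two failures and true at two successes. The left side is
-- then `q`; by `h5` one success suffices in some position, so the right side is at least `q² + q (1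
-- - q) = q`.
open Classical in
lemma bern_pair_le {q : ℝ} (hq0 : 0 ≤ q) (hq1 : q ≤ 1) (T : Bool → Bool → Prop)
    (h1 : T false false → T true false) (h2 : T false false → T false true)
    (h3 : T true false → T true true) (h4 : T false true → T true true)
    (h5 : T true true → T true false ∨ T false true) :
    ex (bern q) (fun x => if T x x then (1 : ℝ) else 0) ≤
      ex (bern q) (fun x => ex (bern q) (fun y => if T x y then (1 : ℝ) else 0)) := by
  simp only [ex, bern, Fintype.sum_bool]
  by_cases h00 : T false false
  · have := h1 h00
    have := h2 h00
    have := h3 (h1 h00)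
    simp [*]
  · by_cases h11 : T true true
    · rcases h5 h11 with h | h
      · by_cases h' : T false true
        · simp [*]; nlinarith [mul_nonneg hq0 (sub_nonneg.2 hq1)]
        · simp [*]
      · by_cases h' : T true false
        · simp [*]; nlinarith [mul_nonneg hq0 (sub_nonneg.2 hq1)]
        · simp [*]; nlinarith [mul_nonneg hq0 (sub_nonneg.2 hq1)]
    · have h10 : ¬ T true false := fun h => h11 (h3 h)
      have h01 : ¬ T false true := fun h => h11 (h4 h)
      simp [*]

-- The coins are split one at a time: `bern_pair_le` handles the first pair, and both hypotheses
-- survive fixing its values.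
open Classical in
lemma pr_diag_le_fin {q : ℝ} (hq0 : 0 ≤ q) (hq1 : q ≤ 1) :
    ∀ (m : ℕ) (U : (Fin m → Bool) → (Fin m → Bool) → Prop),
    (∀ a a' b b', a ≤ a' → b ≤ b' → U a b → U a' b') →
    (∀ i a b, U (Function.update a i true) (Function.update b i true) →
      U (Function.update a i true) (Function.update b i false) ∨
      U (Function.update a i false) (Function.update b i true)) →
    ex (piWeight (Fin m) (bern q)) (fun ω => if U ω ω then (1 : ℝ) else 0) ≤
      ex (piWeight (Fin m) (bern q)) (fun a =>
        ex (piWeight (Fin m) (bern q)) (fun b => if U a b then (1 : ℝ) else 0)) := by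
  intro m
  induction m with
  | zero =>
    intro U _ _
    simp [ex, piWeight, Finset.filter_singleton]
  | succ m ih =>
    intro U hmono hloc
    have hw := isProbWeight_bern hq0 hq1
    have hp := hw.pi (ι := Fin m)
    have hcons : ∀ (x x' : Bool) (a a' : Fin m → Bool), x ≤ x' → a ≤ a' →
        (Fin.cons x a : Fin (m + 1) → Bool) ≤ Fin.cons x' a' := by
      intro x x' a a' hx ha i
      refine Fin.cases ?_ (fun j => ?_) i
      · simpa using hx
      · simpa using ha j
    have hR : ex (piWeight (Fin (m + 1)) (bern q)) (fun a =>
        ex (piWeight (Fin (m + 1)) (bern q)) (fun b => if U a b then (1 : ℝ) else 0)) =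
        ex (bern q) (fun x => ex (bern q) (fun y =>
          ex (piWeight (Fin m) (bern q)) (fun a => ex (piWeight (Fin m) (bern q))
            (fun b => if U (Fin.cons x a) (Fin.cons y b) then (1 : ℝ) else 0)))) := by
      simp only [ex_piWeight_cons]
      rw [ex_comm]
      congr 1; ext x
      rw [ex_comm (bern q)]
      congr 1; ext a
      rw [ex_comm]
    rw [hR, ex_piWeight_cons]
    calc _ ≤ ex (piWeight (Fin m) (bern q)) (fun ω => ex (bern q) (fun x => ex (bern q)
          (fun y => if U (Fin.cons x ω) (Fin.cons y ω) then (1 : ℝ) else 0))) := by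
          refine ex_mono hp fun ω => ?_
          refine bern_pair_le hq0 hq1 (fun x y => U (Fin.cons x ω) (Fin.cons y ω)) ?_ ?_ ?_ ?_ ?_
          · exact hmono _ _ _ _ (hcons _ _ _ _ (by simp) le_rfl) (hcons _ _ _ _ (by simp) le_rfl)
          · exact hmono _ _ _ _ (hcons _ _ _ _ (by simp) le_rfl) (hcons _ _ _ _ (by simp) le_rfl)
          · exact hmono _ _ _ _ (hcons _ _ _ _ (by simp) le_rfl) (hcons _ _ _ _ (by simp) le_rfl)
          · exact hmono _ _ _ _ (hcons _ _ _ _ (by simp) le_rfl) (hcons _ _ _ _ (by simp) le_rfl)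
          · intro h
            have := hloc 0 (Fin.cons true ω) (Fin.cons true ω)
            simp only [Fin.update_cons_zero] at this
            exact this h
      _ = ex (bern q) (fun x => ex (bern q) (fun y => ex (piWeight (Fin m) (bern q))
          (fun ω => if U (Fin.cons x ω) (Fin.cons y ω) then (1 : ℝ) else 0))) := by
          rw [ex_comm]
          congr 1; ext x
          rw [ex_comm]
      _ ≤ _ := by
          refine ex_mono hw fun x => ex_mono hw fun y => ?_
          refine ih (fun a b => U (Fin.cons x a) (Fin.cons y b)) ?_ ?_
          · intro a a' b b' ha hb
            exact hmono _ _ _ _ (hcons _ _ _ _ le_rfl ha) (hcons _ _ _ _ le_rfl hb)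
          · intro i a b
            simp only [Fin.cons_update]
            exact hloc i.succ _ _

/-- Replacing a pair of equal coins by two independent coins makes a monotone event more likely,
provided that the event never needs both coins of the pair. -/
lemma pr_diag_le {ι : Type*} [Fintype ι] [DecidableEq ι] {q : ℝ} (hq0 : 0 ≤ q) (hq1 : q ≤ 1)
    (U : (ι → Bool) → (ι → Bool) → Prop)
    (hmono : ∀ a a' b b', a ≤ a' → b ≤ b' → U a b → U a' b')
    (hloc : ∀ i a b, U (Function.update a i true) (Function.update b i true) →
      U (Function.update a i true) (Function.update b i false) ∨
      U (Function.update a i false) (Function.update b i true)) :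
    pr (piWeight ι (bern q)) (fun ω => U ω ω) ≤
      ex (piWeight ι (bern q)) (fun a => pr (piWeight ι (bern q)) (fun b => U a b)) := by
  classical
  let e : ι ≃ Fin (Fintype.card ι) := Fintype.equivFin ι
  have h := pr_diag_le_fin hq0 hq1 _ (fun a b => U (a ∘ e) (b ∘ e))
    (fun a a' b b' ha hb => hmono _ _ _ _ (fun i => ha _) (fun i => hb _))
    (by
      intro i a b
      simp only [Function.update_comp_equiv]
      exact hloc _ _ _)
  rw [ex_piWeight_reindex (bern q) e (fun ω => if U ω ω then (1 : ℝ) else 0)] at h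
  have h2 : ∀ a : Fin (Fintype.card ι) → Bool, ex (piWeight (Fin (Fintype.card ι)) (bern q))
      (fun b => if U (a ∘ e) (b ∘ e) then (1 : ℝ) else 0) =
      ex (piWeight ι (bern q)) (fun b => if U (a ∘ e) b then (1 : ℝ) else 0) :=
    fun a => ex_piWeight_reindex (bern q) e (fun b => if U (a ∘ e) b then (1 : ℝ) else 0)
  simp_rw [h2] at h
  rw [ex_piWeight_reindex (bern q) e (fun a => ex (piWeight ι (bern q))
    (fun b => if U a b then (1 : ℝ) else 0))] at h
  exact h

variable {V : Type*} [Fintype V] [DecidableEq V]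

lemma FullCycle.apply_apply_ne {π : Equiv.Perm V} (h : FullCycle π) (hV : 3 ≤ Fintype.card V)
    (x : V) : π (π x) ≠ x := by
  intro hx
  obtain ⟨z, hz⟩ : ∃ z, z ∉ ({x, π x} : Finset V) := by
    by_contra hc
    push Not at hc
    have h1 : (Finset.univ : Finset V) ⊆ {x, π x} := fun z _ => hc z
    have h2 := (Finset.card_le_card h1).trans Finset.card_le_two
    rw [Finset.card_univ] at h2
    omega
  obtain ⟨k, hk⟩ := (h x z).exists_nat_pow_eq
  have : ∀ k : ℕ, (π ^ k) x ∈ ({x, π x} : Finset V) := by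
    intro k
    induction k with
    | zero => simp
    | succ k ih =>
      rw [pow_succ', Equiv.Perm.mul_apply]
      rcases Finset.mem_insert.1 ih with h' | h'
      · simp [h']
      · rw [Finset.mem_singleton.1 h', hx]; simp
  exact hz (hk ▸ this k)

lemma cyclesIn_congr {ω ω' : V × V → Bool} (hV : 2 ≤ Fintype.card V)
    (h : ∀ x y, x ≠ y → ω (x, y) = ω' (x, y)) : cyclesIn ω = cyclesIn ω' := by
  ext π
  rw [mem_cyclesIn, mem_cyclesIn]
  refine and_congr_right fun hπ => forall_congr' fun x => ?_
  rw [h x (π x) (hπ.apply_ne hV x).symm]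

/-- The arc set with prescribed non-loops and without loops. -/
def extendArcs (η : {e : V × V // e.1 ≠ e.2} → Bool) : V × V → Bool :=
  fun e => if h : e.1 ≠ e.2 then η ⟨e, h⟩ else false

lemma cyclesIn_extendArcs (hV : 2 ≤ Fintype.card V) (ω : V × V → Bool) :
    cyclesIn (extendArcs (ω ∘ Subtype.val)) = cyclesIn ω :=
  cyclesIn_congr hV fun x y hxy => by simp [extendArcs, hxy]

/-- The cyclic permutation is that of the list; the closing edge supplies the arc at its last
position. -/
lemma HasHamiltonList.nonempty_cyclesIn {ω : V × V → Bool}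
    (h : HasHamiltonList fun x y => ω (x, y) = true) : (cyclesIn ω).Nonempty := by
  obtain ⟨l, ⟨hnd, hch⟩, hlen, x, hx, y, hy, hxy⟩ := h
  have hmem : ∀ z, z ∈ l := by
    intro z
    have : l.toFinset = Finset.univ := by
      rw [← Finset.card_eq_iff_eq_univ, List.toFinset_card_of_nodup hnd, hlen]
    rw [← List.mem_toFinset, this]; simp
  refine ⟨l.formPerm, mem_cyclesIn.2 ⟨fun a b => ?_, fun a => ?_⟩⟩
  · exact hnd.isCycleOn_formPerm.2 (hmem a) (hmem b)
  · obtain ⟨i, hi, rfl⟩ := List.getElem_of_mem (hmem a)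
    rw [List.formPerm_apply_getElem l hnd i hi]
    by_cases h1 : i + 1 < l.length
    · have := List.isChain_iff_getElem.1 hch i h1
      simpa [Nat.mod_eq_of_lt h1] using this
    · have h2 : i + 1 = l.length := by omega
      have h3 : i = l.length - 1 := by omega
      have e1 : l[i] = x := by
        rw [Option.mem_def, List.getLast?_eq_getElem?, ← h3, List.getElem?_eq_getElem hi] at hx
        exact Option.some.inj hx
      have h0 : 0 < l.length := by omega
      have e2 : l[0] = y := by
        rw [Option.mem_def, List.head?_eq_getElem?, List.getElem?_eq_getElem h0] at hy
        exact Option.some.inj hy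
      have e3 : (i + 1) % l.length = 0 := by rw [h2, Nat.mod_self]
      simp only [e3, e1, e2]
      exact hxy

end Coupling

/-! ### Hamiltonicity of the binomial random digraph by McDiarmid's coupling -/

section DirectedHamiltonicity

variable {V : Type*} [Fintype V] [LinearOrder V]

/-- The digraph whose ascending arcs are given by `a` and whose descending arcs by `b`. -/
def orientArcs (a b : Sym2 V → Bool) : V × V → Bool :=
  fun e => if e.1 < e.2 then a s(e.1, e.2) else b s(e.1, e.2)

/-- Loops never lie on a full cycle, and the non-loop arcs embed into two copies of the unordered
pairs, one for each direction. Unused coins integrate out. -/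
lemma pr_nonempty_cyclesIn_eq {q : ℝ} (hq0 : 0 ≤ q) (hq1 : q ≤ 1) (hV : 2 ≤ Fintype.card V) :
    pr (piWeight (V × V) (bern q)) (fun ω => (cyclesIn ω).Nonempty) =
      ex (piWeight (Sym2 V) (bern q)) (fun a => pr (piWeight (Sym2 V) (bern q))
        (fun b => (cyclesIn (orientArcs a b)).Nonempty)) := by
  classical
  have hw := isProbWeight_bern hq0 hq1
  have h1 := pr_piWeight_comp hw (κ := {e : V × V // e.1 ≠ e.2}) Subtype.val_injective
    (fun η => (cyclesIn (extendArcs η)).Nonempty)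
  simp only [cyclesIn_extendArcs hV] at h1
  let g : {e : V × V // e.1 ≠ e.2} → Sym2 V ⊕ Sym2 V := fun e =>
    if e.1.1 < e.1.2 then Sum.inl s(e.1.1, e.1.2) else Sum.inr s(e.1.1, e.1.2)
  have hg : Function.Injective g := by
    rintro ⟨⟨x, y⟩, h⟩ ⟨⟨x', y'⟩, h'⟩ he
    simp only [ne_eq] at h h'
    simp only [g] at he
    rw [Subtype.mk.injEq, Prod.mk.injEq]
    split_ifs at he with h2 h3 h3
    · rcases Sym2.eq_iff.1 (Sum.inl_injective he) with h4 | ⟨rfl, rfl⟩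
      · exact h4
      · exact absurd h2 h3.asymm
    · rcases Sym2.eq_iff.1 (Sum.inr_injective he) with h4 | ⟨rfl, rfl⟩
      · exact h4
      · exact absurd (le_antisymm (not_lt.1 h2) (not_lt.1 h3)) (Ne.symm h)
  have h2 := pr_piWeight_comp hw hg (fun η => (cyclesIn (extendArcs η)).Nonempty)
  rw [h1, ← h2, pr, ex_piWeight_sum]
  unfold pr
  congr 1; ext a
  congr 1; ext b
  have : cyclesIn (extendArcs (Sum.elim a b ∘ g)) = cyclesIn (orientArcs a b) := by
    refine cyclesIn_congr hV fun x y hxy => ?_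
    simp only [extendArcs, orientArcs, g, Function.comp, ne_eq, hxy, not_false_eq_true, dite_true]
    split_ifs <;> rfl
  rw [this]

/-- The binomial random digraph is Hamiltonian above the logarithmic threshold. -/
lemma pr_not_nonempty_cyclesIn_le {q : ℝ} (hq1 : q ≤ 1) (hV : 4 ≤ Fintype.card V)
    (hq : 88 * Real.log (Fintype.card V) / Fintype.card V ≤ q) :
    pr (piWeight (V × V) (bern q)) (fun ω => ¬ (cyclesIn ω).Nonempty) ≤
      2 / (Fintype.card V : ℝ) := by
  have hq0 : 0 ≤ q := le_trans (by positivity) hq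
  have hw := isProbWeight_bern hq0 hq1
  have h1 := pr_not_hasHamiltonList_le hq1 hV hq
  have h2 := pr_diag_le hq0 hq1 (ι := Sym2 V)
    (fun a b => (cyclesIn (orientArcs a b)).Nonempty) ?_ ?_
  · have h3 : pr (piWeight (Sym2 V) (bern q)) (fun ω => HasHamiltonList (edgeRel ω)) ≤
        pr (piWeight (Sym2 V) (bern q)) (fun ω => (cyclesIn (orientArcs ω ω)).Nonempty) := by
      refine pr_mono hw.pi fun ω hω => ?_
      refine HasHamiltonList.nonempty_cyclesIn ?_
      convert hω using 3 with x y
      simp [orientArcs, edgeRel]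
    rw [pr_not hw.pi] at h1 ⊢
    rw [pr_nonempty_cyclesIn_eq hq0 hq1 (by omega)]
    linarith
  · rintro a a' b b' ha hb ⟨π, hπ⟩
    refine ⟨π, cyclesIn_mono (fun e => ?_) hπ⟩
    simp only [orientArcs]
    split_ifs
    · exact ha _
    · exact hb _
  · rintro i a b ⟨π, hπ⟩
    rw [mem_cyclesIn] at hπ
    obtain ⟨hF, hπ⟩ := hπ
    -- A cycle on at least three vertices never uses both directions of the pair `i`: if it uses the
    -- descending arc, the ascending coin may be turned off, and otherwise the descending one.
    by_cases hdesc : ∃ x, ¬ x < π x ∧ s(x, π x) = i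
    · right
      obtain ⟨x, hx, hxi⟩ := hdesc
      refine ⟨π, mem_cyclesIn.2 ⟨hF, fun y => ?_⟩⟩
      have hy := hπ y
      simp only [orientArcs] at hy ⊢
      split_ifs at hy ⊢ with hlt
      · have hne : s(y, π y) ≠ i := by
          intro hyi
          rcases Sym2.eq_iff.1 (hyi.trans hxi.symm) with ⟨rfl, _⟩ | ⟨h4, h5⟩
          · exact hx hlt
          · refine hF.apply_apply_ne (by omega) x ?_
            rw [← h4, h5]
        rw [Function.update_of_ne hne] at hy ⊢
        exact hy
      · exact hy
    · left
      push Not at hdesc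
      refine ⟨π, mem_cyclesIn.2 ⟨hF, fun y => ?_⟩⟩
      have hy := hπ y
      simp only [orientArcs] at hy ⊢
      split_ifs at hy ⊢ with hlt
      · exact hy
      · have hne : s(y, π y) ≠ i := hdesc y (not_lt.1 hlt)
        rw [Function.update_of_ne hne] at hy ⊢
        exact hy

end DirectedHamiltonicity

/-! ### Completing path forests to Hamilton cycles -/

section Completion

open Equiv

variable {V : Type*} [Fintype V]

/-- Take the first return to `R` under `π⁻¹`. At least one step is required, so `y = z` is possible
only after a full turn of the cycle. -/
lemma exists_prev_visit (π : Perm V) (R : Finset V) (z : R) :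
    ∃ y : R, ∃ j : ℕ, (π ^ (j + 1)) y = z ∧ ∀ i, 1 ≤ i → i ≤ j → (π ^ i) y ∉ R := by
  classical
  have hex : ∃ m, 1 ≤ m ∧ (π⁻¹ ^ m) z ∈ R := by
    refine ⟨orderOf π, orderOf_pos π, ?_⟩
    rw [inv_pow, pow_orderOf_eq_one]
    simp
  obtain ⟨h1, h2⟩ := Nat.find_spec hex
  set m := Nat.find hex with hm
  refine ⟨⟨_, h2⟩, m - 1, ?_, fun i hi hij hiR => ?_⟩
  · change (π ^ (m - 1 + 1)) ((π⁻¹ ^ m) z) = z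
    rw [Nat.sub_add_cancel h1, inv_pow]
    simp
  · refine Nat.find_min hex (m := m - i) (by omega) ⟨by omega, ?_⟩
    have : (π ^ i) ((π⁻¹ ^ m) z) = (π⁻¹ ^ (m - i)) z := by
      rw [← Perm.mul_apply]
      congr 1
      have : m = i + (m - i) := by omega
      conv_lhs => rw [this, pow_add, inv_pow]
      rw [mul_inv_cancel_left]
    rw [← this]
    exact hiR

/-- The element of `R` visited by `π` last before `z`. -/
noncomputable def prevVisit (π : Perm V) (R : Finset V) (z : R) : R :=
  (exists_prev_visit π R z).choose

lemma prevVisit_spec (π : Perm V) (R : Finset V) (z : R) :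
    ∃ j : ℕ, (π ^ (j + 1)) (prevVisit π R z) = z ∧
      ∀ i, 1 ≤ i → i ≤ j → (π ^ i) (prevVisit π R z) ∉ R :=
  (exists_prev_visit π R z).choose_spec

lemma prevVisit_injective (π : Perm V) (R : Finset V) :
    Function.Injective (prevVisit π R) := by
  intro z z' h
  obtain ⟨j, hj, hj'⟩ := prevVisit_spec π R z
  obtain ⟨k, hk, hk'⟩ := prevVisit_spec π R z'
  rw [← h] at hk hk'
  have hjk : j = k := by
    rcases lt_trichotomy j k with hlt | heq | hgt
    · exact absurd (hj ▸ z.2) (hk' (j + 1) (by omega) (by omega))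
    · exact heq
    · exact absurd (hk ▸ z'.2) (hj' (k + 1) (by omega) (by omega))
  subst hjk
  exact Subtype.ext (hj.symm.trans hk)

/-- A Hamilton cycle of the contracted digraph on `R` yields a cyclic permutation that agrees with
`π` outside `R`. -/
lemma exists_fullCycle_of_contracted [DecidableEq V] {π : Perm V} (hπ : FullCycle π)
    {R : Finset V} (hR : R.Nonempty) {τ : Perm R} (hτ : FullCycle τ) :
    ∃ ρ : Perm V, FullCycle ρ ∧ (∀ x ∉ R, ρ x = π x) ∧
      ∀ x : R, ρ x = π (prevVisit π R (τ x)) := by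
  -- Deleting the arcs of `π` out of `R` leaves paths ending at the points of `R`. The new arc from
  -- `x` enters the path ending at `τ x` at its first vertex, so following `ρ` from `x` next meets
  -- `R` at `τ x`.
  let θ : Perm R := Equiv.ofBijective _
    (Finite.injective_iff_bijective.1 (prevVisit_injective π R)) * τ
  let ρ : Perm V := π * Perm.ofSubtype θ
  have hout : ∀ x ∉ R, ρ x = π x := by
    intro x hx
    simp only [ρ, Perm.mul_apply]
    rw [Perm.ofSubtype_apply_of_not_mem θ hx]
  have hin : ∀ x : R, ρ x = π (prevVisit π R (τ x)) := by
    intro x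
    simp only [ρ, Perm.mul_apply, Perm.ofSubtype_apply_coe]
    rfl
  refine ⟨ρ, ?_, hout, hin⟩
  have hstep : ∀ x : R, ρ.SameCycle x (τ x) := by
    intro x
    obtain ⟨j, hj, hj'⟩ := prevVisit_spec π R (τ x)
    have : ∀ i ≤ j, ρ.SameCycle x ((π ^ (i + 1)) (prevVisit π R (τ x))) := by
      intro i
      induction i with
      | zero =>
        intro _
        rw [zero_add, pow_one, ← hin x]
        exact Perm.sameCycle_apply_right.2 (Perm.SameCycle.refl _ _)
      | succ i ih =>
        intro hi
        rw [pow_succ', Perm.mul_apply, ← hout _ (hj' (i + 1) (by omega) (by omega))]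
        exact Perm.sameCycle_apply_right.2 (ih (by omega))
    rw [← hj]
    exact this j le_rfl
  have hRR : ∀ x y : R, ρ.SameCycle x y := by
    intro x y
    obtain ⟨k, rfl⟩ := (hτ x y).exists_nat_pow_eq
    induction k with
    | zero => exact Perm.SameCycle.refl _ _
    | succ k ih =>
      rw [pow_succ', Perm.mul_apply]
      exact ih.trans (hstep _)
  have hreach : ∀ v, ∃ x : R, ρ.SameCycle v x := by
    intro v
    classical
    obtain ⟨r, hr⟩ := hR
    have hex : ∃ k : ℕ, (π ^ k) v ∈ R := by
      obtain ⟨k, hk⟩ := (hπ v r).exists_nat_pow_eq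
      exact ⟨k, hk ▸ hr⟩
    refine ⟨⟨_, Nat.find_spec hex⟩, ?_⟩
    have : ∀ i ≤ Nat.find hex, ρ.SameCycle v ((π ^ i) v) := by
      intro i
      induction i with
      | zero => intro _; exact Perm.SameCycle.refl _ _
      | succ i ih =>
        intro hi
        rw [pow_succ', Perm.mul_apply, ← hout _ (Nat.find_min hex (by omega))]
        exact Perm.sameCycle_apply_right.2 (ih (by omega))
    exact this _ le_rfl
  intro x y
  obtain ⟨a, ha⟩ := hreach x
  obtain ⟨b, hb⟩ := hreach y
  exact (ha.trans (hRR a b)).trans hb.symm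

variable [LinearOrder V]

/-- An arc `(x, z)` of the contracted digraph stands for the arc from `x` to the start of the path
ending at `z`. This correspondence is injective, so the contracted digraph is again binomial with
density `q`. -/
lemma pr_not_completable_le {q : ℝ} (hq1 : q ≤ 1) {R : Finset V} (hR : 4 ≤ R.card)
    (hq : 88 * Real.log R.card / R.card ≤ q) {A A' : V × V → Bool}
    (hA : ∀ x ∉ R, ∀ y, A (x, y) = A' (x, y)) {π : Perm V} (hπ : π ∈ cyclesIn A') :
    pr (piWeight (V × V) (bern q))
      (fun b => ¬ ∃ ρ ∈ cyclesIn (A ⊔ b), ∀ x ∉ R, ρ x = π x) ≤ 2 / (R.card : ℝ) := by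
  rw [mem_cyclesIn] at hπ
  have hq0 : 0 ≤ q := le_trans (by positivity) hq
  have hw := isProbWeight_bern hq0 hq1
  have hcard : Fintype.card R = R.card := Fintype.card_coe R
  have h1 := pr_not_nonempty_cyclesIn_le (V := R) hq1 (by rw [hcard]; exact hR)
    (by rw [hcard]; exact hq)
  rw [hcard] at h1
  let g : R × R → V × V := fun e => (e.1, π (prevVisit π R e.2))
  have hg : Function.Injective g := by
    rintro ⟨x, z⟩ ⟨x', z'⟩ h
    have h2 := Prod.ext_iff.1 h
    exact Prod.ext (Subtype.ext h2.1)
      (prevVisit_injective π R (Subtype.ext (π.injective h2.2)))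
  have h2 : pr (piWeight (V × V) (bern q)) (fun b => ¬ (cyclesIn (b ∘ g)).Nonempty) ≤
      2 / (R.card : ℝ) := by
    rw [pr_piWeight_comp hw hg (fun η => ¬ (cyclesIn η).Nonempty)]
    convert h1
  refine (pr_mono hw.pi fun b hb hne => hb ?_).trans h2
  obtain ⟨τ, hτ⟩ := hne
  rw [mem_cyclesIn] at hτ
  obtain ⟨ρ, hρ, hout, hin⟩ := exists_fullCycle_of_contracted hπ.1
    (Finset.card_pos.1 (by omega : 0 < R.card)) hτ.1
  refine ⟨ρ, mem_cyclesIn.2 ⟨hρ, fun x => ?_⟩, hout⟩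
  by_cases hx : x ∈ R
  · have h3 : b (x, ρ x) = true := by
      rw [hin ⟨x, hx⟩]; exact hτ.2 ⟨x, hx⟩
    simp [h3]
  · have h3 : A (x, ρ x) = true := by
      rw [hout x hx, hA x hx]; exact hπ.2 x
    simp [h3]

/-- The expected number of cycles that cannot be completed is at most `2N / |R|`, so by Markov at
least half can be, up to probability `4 / |R|`. A completion determines its origin off `R`, hence
has at most `|R|!` origins. -/
lemma pr_few_completions_le {q : ℝ} (hq1 : q ≤ 1) {R : Finset V} (hR : 4 ≤ R.card)
    (hq : 88 * Real.log R.card / R.card ≤ q) {A A' : V × V → Bool}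
    (hA : ∀ x ∉ R, ∀ y, A (x, y) = A' (x, y)) :
    pr (piWeight (V × V) (bern q)) (fun b => ¬ (((cyclesIn A').card : ℝ) ≤
      2 * (R.card.factorial * (cyclesIn (A ⊔ b)).card))) ≤ 4 / (R.card : ℝ) := by
  classical
  have hq0 : 0 ≤ q := le_trans (by positivity) hq
  have hw := (isProbWeight_bern hq0 hq1).pi (ι := V × V)
  have hR0 : (0 : ℝ) < R.card := by have : 0 < R.card := by omega
                                    exact_mod_cast this
  set N := (cyclesIn A').card with hN
  let bad : (V × V → Bool) → Perm V → Prop := fun b π =>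
    ¬ ∃ ρ ∈ cyclesIn (A ⊔ b), ∀ x ∉ R, ρ x = π x
  let F : (V × V → Bool) → ℝ := fun b => ∑ π ∈ cyclesIn A', if bad b π then 1 else 0
  have hF0 : ∀ b, 0 ≤ F b := fun b => Finset.sum_nonneg fun _ _ => by split_ifs <;> norm_num
  have hF : ∀ b, F b = ((cyclesIn A').filter (bad b)).card := by
    intro b
    simp only [F]
    rw [Finset.card_filter]
    push_cast
    rfl
  rcases Nat.eq_zero_or_pos N with h0 | hpos
  · have : ∀ b, ((N : ℝ) ≤ 2 * (R.card.factorial * (cyclesIn (A ⊔ b)).card)) := by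
      intro b; rw [h0]; push_cast; positivity
    simp only [this, not_true]
    simp [pr, ex]
    positivity
  have hNpos : (0 : ℝ) < N := by exact_mod_cast hpos
  have hEF : ex (piWeight (V × V) (bern q)) F ≤ N * (2 / R.card) := by
    rw [ex_sum, hN, ← nsmul_eq_mul]
    refine Finset.sum_le_card_nsmul _ _ _ fun π hπ => ?_
    have := pr_not_completable_le hq1 hR hq hA hπ
    unfold pr at this
    refine le_trans (le_of_eq (Finset.sum_congr rfl fun b _ => ?_)) this
    simp only [bad]
    congr
  have hmk := mul_pr_le_ex hw hF0 (N / 2)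
  have hgood : ∀ b, ¬ ((N : ℝ) ≤ 2 * (R.card.factorial * (cyclesIn (A ⊔ b)).card)) →
      (N : ℝ) / 2 ≤ F b := by
    intro b hb
    by_contra hlt
    push Not at hlt
    apply hb
    have hsplit := Finset.card_filter_add_card_filter_not (s := cyclesIn A') (p := bad b)
    have hmap : ((cyclesIn A').filter fun π => ¬ bad b π).card ≤
        R.card.factorial * (cyclesIn (A ⊔ b)).card := by
      have hch : ∀ π : Perm V, ∃ ρ : Perm V, ¬ bad b π →
          ρ ∈ cyclesIn (A ⊔ b) ∧ ∀ x ∉ R, ρ x = π x := by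
        intro π
        by_cases h : bad b π
        · exact ⟨1, fun h' => absurd h h'⟩
        · obtain ⟨ρ, h1, h2⟩ := not_not.1 h
          exact ⟨ρ, fun _ => ⟨h1, h2⟩⟩
      choose f hf using hch
      refine Finset.card_le_mul_card_image_of_maps_to (f := f) (fun π hπ => ?_) _ fun ρ hρ => ?_
      · exact (hf π (Finset.mem_filter.1 hπ).2).1
      · have h1 := card_perm_agree_le ρ Rᶜ
        rw [Finset.card_compl, Nat.sub_sub_self (Finset.card_le_univ R)] at h1
        refine (Finset.card_le_card fun π hπ => ?_).trans h1
        rw [Finset.mem_filter, Finset.mem_filter] at hπ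
        rw [Finset.mem_filter]
        refine ⟨Finset.mem_univ _, fun x hx => ?_⟩
        rw [← hπ.2]
        exact ((hf π hπ.1.2).2 x (by simpa using hx)).symm
    rw [hF] at hlt
    have h2 : (((cyclesIn A').filter fun π => ¬ bad b π).card : ℝ) ≤
        R.card.factorial * (cyclesIn (A ⊔ b)).card := by exact_mod_cast hmap
    have h3 : (((cyclesIn A').filter (bad b)).card : ℝ) +
        ((cyclesIn A').filter fun π => ¬ bad b π).card = N := by exact_mod_cast hsplit
    linarith
  have h5 := pr_mono hw hgood
  have h6 : (N : ℝ) / 2 * pr (piWeight (V × V) (bern q)) (fun b => (N : ℝ) / 2 ≤ F b) ≤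
      N / 2 * (4 / R.card) := by
    refine hmk.trans (hEF.trans (le_of_eq ?_)); ring
  exact h5.trans (le_of_mul_le_mul_left h6 (by positivity))

end Completion

/-! ### Combining concentration with the completion of path forests -/

section LowerBound

/-- Quantitative lower bound on the number of Hamilton cycles of the binomial random digraph. -/
lemma pr_card_cyclesIn_lt_le {n r : ℕ} {p p₁ p₂ : ℝ} (hr : 4 ≤ r) (hrn : r ≤ n)
    (h10 : 0 < p₁) (h11 : p₁ ≤ 1) (h21 : p₂ ≤ 1) (hp : 1 - p = (1 - p₁) * (1 - p₂))
    (h2 : 88 * Real.log r / r ≤ p₂) :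
    pr (piWeight (Fin n × Fin n) (bern p)) (fun ω => ¬ ((n.factorial : ℝ) * p₁ ^ n ≤
      4 * (n * (r.factorial * (cyclesIn ω).card)))) ≤
      4 * (n * Real.exp p₁⁻¹) * Real.exp (-(r : ℝ) ^ 2 / (4 * n)) + 4 / r := by
  classical
  have hn0 : (0 : ℝ) < n := by have : 0 < n := by omega
                               exact_mod_cast this
  have h20 : 0 ≤ p₂ := le_trans (by positivity) h2
  have hw1 := (isProbWeight_bern h10.le h11).pi (ι := Fin n × Fin n)
  have hwr := (isProbWeight_bern h10.le h11).pi (ι := Fin n)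
  have hw2 := (isProbWeight_bern h20 h21).pi (ι := Fin n × Fin n)
  set H : ℝ := ((fullCycles (Fin n)).card : ℝ) with hH
  have hHn : (n.factorial : ℝ) ≤ n * H := by
    have := factorial_le_card_mul_card_fullCycles (V := Fin n) (by simp; omega)
    rw [Fintype.card_fin] at this
    rw [hH]; exact_mod_cast this
  -- The coordinates are whole out-neighbourhoods. There are thus only `n` of them in the
  -- concentration bound, and changing `r` coordinates affects only arcs out of `r` vertices.
  let S : (Fin n → Fin n → Bool) → Prop := fun ω =>
    H * p₁ ^ n / 2 ≤ ((cyclesIn fun e => ω e.1 e.2).card : ℝ)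
  let close : (Fin n × Fin n → Bool) → Prop := fun A => HammingClose S r fun i j => A (i, j)
  have hS : 1 / (4 * (n * Real.exp p₁⁻¹)) ≤ pr (piWeight (Fin n) (piWeight (Fin n) (bern p₁))) S := by
    have := le_pr_card_cyclesIn_ge (V := Fin n) h10 h11 (by simp; omega)
    rw [Fintype.card_fin, pr, ex_piWeight_curry] at this
    exact this
  have hclose : pr (piWeight (Fin n × Fin n) (bern p₁)) (fun A => ¬ close A) ≤
      4 * (n * Real.exp p₁⁻¹) * Real.exp (-(r : ℝ) ^ 2 / (4 * n)) := by
    have h3 := pr_mul_pr_not_hammingClose_le hwr (by omega : 0 < n) S r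
    have h4 : pr (piWeight (Fin n × Fin n) (bern p₁)) (fun A => ¬ close A) =
        pr (piWeight (Fin n) (piWeight (Fin n) (bern p₁))) (fun ω => ¬ HammingClose S r ω) := by
      rw [pr, ex_piWeight_curry]
      rfl
    rw [h4]
    set P := pr (piWeight (Fin n) (piWeight (Fin n) (bern p₁))) (fun ω => ¬ HammingClose S r ω)
    have hP : 0 ≤ P := pr_nonneg hwr.pi _
    have h5 := (mul_le_mul_of_nonneg_right hS hP).trans h3
    rw [div_mul_eq_mul_div, one_mul, div_le_iff₀ (by positivity)] at h5
    linarith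
  rw [← pr_bern_sup hp]
  refine (pr_le_add_ex_pr hw1 hw2 (s := fun A => ¬ close A) (δ := 4 / r) (by positivity)
    fun A hA => ?_).trans (by linarith)
  obtain ⟨R₀, hR₀, ω', hω', hag⟩ := not_not.1 hA
  obtain ⟨R, hR₀R, hRc⟩ := Finset.exists_superset_card_eq hR₀ (by simpa using hrn)
  have h6 := pr_few_completions_le (V := Fin n) h21 (R := R) (by omega) (by rw [hRc]; exact h2)
    (A := A) (A' := fun e => ω' e.1 e.2)
    (fun x hx y => congrFun (hag x fun h => hx (hR₀R h)) y)
  rw [hRc] at h6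
  refine (pr_mono hw2 fun b hb hc => hb ?_).trans h6
  have h7 : H * p₁ ^ n / 2 ≤ 2 * (r.factorial * (cyclesIn (A ⊔ b)).card) := hω'.trans hc
  calc (n.factorial : ℝ) * p₁ ^ n ≤ n * H * p₁ ^ n := by gcongr
    _ = 2 * n * (H * p₁ ^ n / 2) := by ring
    _ ≤ 2 * n * (2 * (r.factorial * (cyclesIn (A ⊔ b)).card)) := by gcongr
    _ = _ := by ring

end LowerBound

/-! ### The random digraph as a product weight -/

section Transfer

/-- Coins are tossed on all of `ι` and those outside `u` ignored; the two distributions are compared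
on singletons. -/
lemma setBernoulli_real_eq_pr {ι : Type*} [Fintype ι] [DecidableEq ι] (u : Set ι) (p : I)
    (S : Set (Set ι)) :
    (setBernoulli u p).real S =
      pr (piWeight ι (bern (p : ℝ))) (fun ω => {i | i ∈ u ∧ ω i = true} ∈ S) := by
  classical
  have h1 : ∀ s : Set ι, (setBernoulli u p).real {s} =
      pr (piWeight ι (bern (p : ℝ))) (fun ω => {i | i ∈ u ∧ ω i = true} = s) := by
    intro s
    by_cases hs : s ⊆ u
    · rw [setBernoulli_real_singleton p hs (Set.toFinite u)]
      have h2 := ex_piWeight_prod (ι := ι) (bern (p : ℝ))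
        (fun i b => if i ∈ u then (if (b = true ↔ i ∈ s) then 1 else 0) else 1)
      have h3 : ∀ i, ex (bern (p : ℝ)) (fun b => if i ∈ u then
          (if (b = true ↔ i ∈ s) then (1 : ℝ) else 0) else 1) =
          (if i ∈ s then (p : ℝ) else 1) * (if i ∈ u \ s then 1 - (p : ℝ) else 1) := by
        intro i
        by_cases hi : i ∈ u
        · by_cases his : i ∈ s <;> simp [ex, bern, hi, his]
        · have his : i ∉ s := fun h => hi (hs h)
          simp [ex, bern, hi, his]
      rw [Finset.prod_congr rfl fun i _ => h3 i, Finset.prod_mul_distrib] at h2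
      rw [← Finset.prod_filter, ← Finset.prod_filter, Finset.prod_const, Finset.prod_const] at h2
      rw [Set.ncard_eq_toFinset_card', Set.ncard_eq_toFinset_card']
      have e1 : s.toFinset = Finset.univ.filter (fun i => i ∈ s) := by ext; simp
      have e2 : (u \ s).toFinset = Finset.univ.filter (fun i => i ∈ u \ s) := by ext; simp
      rw [e1, e2, ← h2, pr]
      congr 1; ext ω
      by_cases h : {i | i ∈ u ∧ ω i = true} = s
      · rw [if_pos h]
        refine Finset.prod_eq_one fun i _ => ?_
        by_cases hi : i ∈ u
        · rw [← h]; simp [hi]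
        · simp [hi]
      · rw [if_neg h]
        have : ∃ i, i ∈ u ∧ ¬ (ω i = true ↔ i ∈ s) := by
          by_contra hc
          push Not at hc
          apply h
          ext i
          constructor
          · rintro ⟨hi, hi'⟩; exact ((hc i hi).1 hi')
          · intro hi; exact ⟨hs hi, (hc i (hs hi)).2 hi⟩
        obtain ⟨i, hi, hi'⟩ := this
        exact Finset.prod_eq_zero (Finset.mem_univ i) (by simp only [hi, if_true, hi', if_false])
    · have h2 : ∀ ω : ι → Bool, {i | i ∈ u ∧ ω i = true} ≠ s := by
        rintro ω rfl
        exact hs fun i hi => hi.1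
      rw [measureReal_def, setBernoulli_singleton_of_not_subset p hs]
      simp [pr, ex, h2]
  have h2 : S = (S.toFinset : Set (Set ι)) := by simp
  have h3 : (setBernoulli u p).real S = ∑ s ∈ S.toFinset, (setBernoulli u p).real {s} := by
    conv_lhs => rw [h2]
    rw [sum_measureReal_singleton]
  rw [h3, Finset.sum_congr rfl fun s _ => h1 s]
  simp only [pr]
  rw [← ex_sum]
  congr 1; ext ω
  split_ifs with h
  · rw [Finset.sum_eq_single_of_mem _ (Set.mem_toFinset.2 h)]
    · simp
    · intro b _ hb
      rw [if_neg hb.symm]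
  · refine Finset.sum_eq_zero fun b hb => ?_
    rw [if_neg]
    rintro rfl
    exact h (Set.mem_toFinset.1 hb)

namespace Digraph

/-- The arcs of a permutation, as a digraph. -/
def ofPerm {V : Type*} (π : Equiv.Perm V) : Digraph V where
  Adj x y := y = π x

lemma ofPerm_injective {V : Type*} : Function.Injective (ofPerm (V := V)) := by
  intro π τ h
  ext x
  have : (ofPerm π).Adj x (π x) := rfl
  rw [h] at this
  exact this

/-- A permutation with a single cycle of length `n` is conjugate to `finRotate n`, and the
conjugating bijection is the vertex list. -/
lemma isHamiltonCycle_iff {n : ℕ} (hn : 2 ≤ n) (H : Digraph (Fin n)) :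
    H.IsHamiltonCycle ↔ ∃ π : Equiv.Perm (Fin n), FullCycle π ∧ H = ofPerm π := by
  constructor
  · rintro ⟨k, v, hk, h⟩
    obtain rfl : k = n := Fin.equiv_iff_eq.1 ⟨v⟩
    refine ⟨v * finRotate k * v⁻¹, fullCycle_of_cycleType ?_, ?_⟩
    · rw [Equiv.Perm.cycleType_conj, cycleType_finRotate_of_le hk, Fintype.card_fin]
    · ext x y
      rw [h]
      constructor
      · rintro ⟨i, rfl, rfl⟩
        simp [ofPerm]
      · intro hxy
        exact ⟨v⁻¹ x, by simp, hxy⟩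
  · rintro ⟨π, hπ, rfl⟩
    have hc := hπ.cycleType_eq (by simpa using hn)
    rw [Fintype.card_fin, ← cycleType_finRotate_of_le hn] at hc
    obtain ⟨c, hc⟩ := isConj_iff.1 (Equiv.Perm.isConj_iff_cycleType_eq.2 hc.symm)
    refine ⟨n, c, hn, fun x y => ?_⟩
    rw [← hc]
    constructor
    · intro hxy
      exact ⟨c⁻¹ x, by simp, hxy⟩
    · rintro ⟨i, rfl, rfl⟩
      simp [ofPerm]

lemma hamiltonCycleCount_ofArcSet {n : ℕ} (hn : 2 ≤ n) (ω : Fin n × Fin n → Bool) :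
    (ofArcSet {e | e ∈ {e : Fin n × Fin n | e.1 ≠ e.2} ∧ ω e = true}).hamiltonCycleCount =
      (cyclesIn ω).card := by
  rw [hamiltonCycleCount, ← Set.ncard_coe_finset, ← Set.ncard_image_of_injective _ ofPerm_injective]
  congr 1
  ext H
  simp only [Set.mem_ofPred_eq, Set.mem_image, Finset.mem_coe, mem_cyclesIn]
  rw [isHamiltonCycle_iff hn]
  constructor
  · rintro ⟨⟨π, hπ, rfl⟩, hle⟩
    exact ⟨π, ⟨hπ, fun x => (hle (show (ofPerm π).Adj x (π x) from rfl)).2⟩, rfl⟩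
  · rintro ⟨π, ⟨hπ, h⟩, rfl⟩
    refine ⟨⟨π, hπ, rfl⟩, ?_⟩
    rintro x y rfl
    exact ⟨(hπ.apply_ne (by simpa using hn) x).symm, h x⟩

lemma binomialRandom_real_eq_pr {n : ℕ} (hn : 2 ≤ n) (p : I) (Q : ℕ → Prop) :
    (binomialRandom n p).real {D | Q D.hamiltonCycleCount} =
      pr (piWeight (Fin n × Fin n) (bern (p : ℝ))) (fun ω => Q (cyclesIn ω).card) := by
  rw [binomialRandom, map_measureReal_apply (measurable_of_countable _) (MeasurableSet.of_discrete),
    setBernoulli_real_eq_pr]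
  congr 1
  ext ω
  change Q (ofArcSet _).hamiltonCycleCount ↔ _
  rw [hamiltonCycleCount_ofArcSet hn]

end Digraph

end Transfer

/-! ### Asymptotics -/

section Asymptotic

lemma exists_tendsto_atTop_diagonal {f : ℕ → ℕ → ℝ} (h1 : ∀ k n, f k n ≤ 1)
    (h : ∀ k, Tendsto (f k) atTop (𝓝 1)) :
    ∃ κ : ℕ → ℕ, Tendsto κ atTop atTop ∧ Tendsto (fun n => f (κ n) n) atTop (𝓝 1) := by
  classical
  have hN : ∀ k : ℕ, ∃ N, ∀ n ≥ N, 1 - 1 / ((k : ℝ) + 1) ≤ f k n := fun k =>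
    eventually_atTop.1 ((h k).eventually (eventually_ge_nhds
      (sub_lt_self 1 (by positivity : (0 : ℝ) < 1 / ((k : ℝ) + 1)))))
  choose N hN using hN
  -- The largest `k ≤ n` whose threshold has been passed. The value defaults to `0` if there is
  -- none, so the bound is claimed only for `n ≥ N 0`.
  let κ : ℕ → ℕ := fun n => Nat.findGreatest (fun k => N k ≤ n) n
  have hκ : Tendsto κ atTop atTop := by
    refine tendsto_atTop.2 fun k => ?_
    filter_upwards [eventually_ge_atTop (max k (N k))] with n hn
    exact Nat.le_findGreatest (le_of_max_le_left hn) (le_of_max_le_right hn)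
  refine ⟨κ, hκ, ?_⟩
  have hlow : Tendsto (fun n => 1 - 1 / ((κ n : ℝ) + 1)) atTop (𝓝 1) := by
    have := (tendsto_one_div_add_atTop_nhds_zero_nat (𝕜 := ℝ)).comp hκ
    simpa using this.const_sub 1
  refine tendsto_of_tendsto_of_tendsto_of_le_of_le' hlow tendsto_const_nhds ?_
    (Eventually.of_forall fun n => h1 _ _)
  filter_upwards [eventually_ge_atTop (N 0)] with n hn
  exact hN _ _ (Nat.findGreatest_spec (P := fun k => N k ≤ n) (Nat.zero_le n) hn)

lemma pr_card_cyclesIn_gt_le {n : ℕ} {p c : ℝ} (h0 : 0 < p) (h1 : p ≤ 1) (hc : 0 < c) :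
    pr (piWeight (Fin n × Fin n) (bern p)) (fun ω => ¬ (((cyclesIn ω).card : ℝ) ≤
      c * n.factorial * p ^ n)) ≤ 1 / c := by
  have hw := (isProbWeight_bern h0.le h1).pi (ι := Fin n × Fin n)
  have h2 := mul_pr_le_ex hw (f := fun ω => ((cyclesIn ω).card : ℝ)) (fun _ => by positivity)
    (c * n.factorial * p ^ n)
  rw [ex_card_cyclesIn, Fintype.card_fin] at h2
  have h3 : ((fullCycles (Fin n)).card : ℝ) ≤ n.factorial := by
    have := card_fullCycles_le (V := Fin n)
    rw [Fintype.card_fin] at this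
    exact_mod_cast this
  refine (pr_mono hw (t := fun ω => c * n.factorial * p ^ n ≤ ((cyclesIn ω).card : ℝ))
    fun ω h => (not_le.1 h).le).trans ?_
  rw [le_div_iff₀ hc]
  have hpos : 0 < (n.factorial : ℝ) * p ^ n := by positivity
  refine le_of_mul_le_mul_left ?_ hpos
  calc (n.factorial : ℝ) * p ^ n * (pr _ _ * c) = c * n.factorial * p ^ n * pr _ _ := by ring
    _ ≤ (fullCycles (Fin n)).card * p ^ n := h2
    _ ≤ n.factorial * p ^ n * 1 := by rw [mul_one]; gcongr

/-- The number of path ends left open, a small multiple of `n / log n`. -/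
noncomputable def gapCount (η : ℝ) (n : ℕ) : ℕ := ⌊η * n / Real.log n⌋₊

lemma tendsto_log_pow_div_atTop (k : ℕ) :
    Tendsto (fun n : ℕ => Real.log n ^ k / n) atTop (𝓝 0) := by
  have h2 : (fun x : ℝ => Real.log x ^ k) =o[atTop] (fun x : ℝ => x) := by
    exact Real.isLittleO_pow_log_id_atTop
  exact h2.tendsto_div_nhds_zero.comp tendsto_natCast_atTop_atTop

lemma tendsto_div_log_atTop {η : ℝ} (hη : 0 < η) :
    Tendsto (fun n : ℕ => η * n / Real.log n) atTop atTop := by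
  have h1 := tendsto_log_pow_div_atTop 1
  have h2 : Tendsto (fun n : ℕ => Real.log n ^ 1 / n) atTop (𝓝[>] 0) := by
    refine tendsto_nhdsWithin_iff.2 ⟨h1, ?_⟩
    filter_upwards [eventually_gt_atTop 1] with n hn
    have : 0 < Real.log n := Real.log_pos (by exact_mod_cast hn)
    have : 0 < n := by omega
    simp only [Set.mem_Ioi, pow_one]
    positivity
  have h3 := (tendsto_inv_nhdsGT_zero.comp h2).const_mul_atTop hη
  refine h3.congr fun n => ?_
  simp only [Function.comp, pow_one, inv_div]
  ring

lemma tendsto_gapCount {η : ℝ} (hη : 0 < η) : Tendsto (gapCount η) atTop atTop :=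
  tendsto_nat_floor_atTop.comp (tendsto_div_log_atTop hη)

/-- Since `1 - ε ≤ (1 - ε/2)²`, one factor `1 - ε/2` pays for `p₁` in place of `q`, and the other
for `exp (ε n / 2)`. The latter is split equally between `r! ≤ n^r` and `4n ≤ n³`. -/
lemma one_sub_pow_mul_factorial_le {n r : ℕ} {ε q p₁ X : ℝ} (h0 : 0 < ε) (h1 : ε < 1)
    (hq0 : 0 ≤ q) (hn : 8 ≤ n) (hrn : r ≤ n) (hr : r * Real.log n ≤ ε / 4 * n)
    (hlog : 3 * Real.log n ≤ ε / 4 * n) (hp₁ : (1 - ε / 2) * q ≤ p₁) (hX0 : 0 ≤ X)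
    (hX : (n.factorial : ℝ) * p₁ ^ n ≤ 4 * (n * (r.factorial * X))) :
    (1 - ε) ^ n * n.factorial * q ^ n ≤ X := by
  have hn8 : (8 : ℝ) ≤ n := by exact_mod_cast hn
  have hn0 : (0 : ℝ) < n := by linarith
  have hfac : (r.factorial : ℝ) ≤ Real.exp (ε / 4 * n) := by
    have h3 : (r.factorial : ℝ) ≤ (n : ℝ) ^ r := by
      have : r.factorial ≤ n ^ r := (Nat.factorial_le_pow r).trans (Nat.pow_le_pow_left hrn r)
      exact_mod_cast this
    have h4 : (n : ℝ) ^ r = Real.exp (r * Real.log n) := by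
      rw [Real.exp_nat_mul, Real.exp_log hn0]
    exact h3.trans (h4 ▸ Real.exp_le_exp.2 hr)
  have h4n : 4 * (n : ℝ) ≤ Real.exp (ε / 4 * n) := by
    have h6 : 4 * (n : ℝ) ≤ n ^ 3 := by nlinarith [mul_nonneg hn0.le hn0.le]
    have h7 : (n : ℝ) ^ 3 = Real.exp (3 * Real.log n) := by
      have := Real.exp_nat_mul (Real.log n) 3
      rw [Real.exp_log hn0] at this
      rw [← this]; norm_num
    exact h6.trans (h7 ▸ Real.exp_le_exp.2 hlog)
  have hup : (n.factorial : ℝ) * p₁ ^ n ≤ Real.exp (ε / 2 * n) * X := by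
    refine hX.trans ?_
    calc 4 * (n * (r.factorial * X)) = 4 * n * r.factorial * X := by ring
      _ ≤ Real.exp (ε / 4 * n) * Real.exp (ε / 4 * n) * X := by gcongr
      _ = Real.exp (ε / 2 * n) * X := by rw [← Real.exp_add]; ring_nf
  have hexp : Real.exp (ε / 2 * n) * (1 - ε / 2) ^ n ≤ 1 := by
    have h8 : (1 - ε / 2) ^ n ≤ Real.exp (-(ε / 2 * n)) :=
      one_sub_pow_le_exp (by linarith) n le_rfl
    calc _ ≤ Real.exp (ε / 2 * n) * Real.exp (-(ε / 2 * n)) := by gcongr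
      _ = 1 := by rw [← Real.exp_add]; simp
  have hbase : (1 - ε) * q ≤ (1 - ε / 2) * p₁ := by
    have h9 : 0 ≤ (ε / 2) ^ 2 * q := by positivity
    calc (1 - ε) * q ≤ (1 - ε / 2) * ((1 - ε / 2) * q) := by linarith
      _ ≤ _ := mul_le_mul_of_nonneg_left hp₁ (by linarith)
  calc (1 - ε) ^ n * n.factorial * q ^ n = n.factorial * ((1 - ε) * q) ^ n := by
        rw [mul_pow]; ring
    _ ≤ n.factorial * ((1 - ε / 2) * p₁) ^ n :=
        mul_le_mul_of_nonneg_left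
          (pow_le_pow_left₀ (mul_nonneg (by linarith) hq0) hbase n) (by positivity)
    _ = (1 - ε / 2) ^ n * (n.factorial * p₁ ^ n) := by rw [mul_pow]; ring
    _ ≤ (1 - ε / 2) ^ n * (Real.exp (ε / 2 * n) * X) :=
        mul_le_mul_of_nonneg_left hup (pow_nonneg (by linarith) _)
    _ = (Real.exp (ε / 2 * n) * (1 - ε / 2) ^ n) * X := by ring
    _ ≤ 1 * X := mul_le_mul_of_nonneg_right hexp hX0
    _ = X := one_mul _

/-- The concentration exponent `r² / (4n)` is at least `η² n / (16 log² n)`. Half of it absorbs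
`1/p₁`, and the other half exceeds `2 log n`. -/
lemma exp_inv_mul_exp_le {n r : ℕ} {η q p₁ : ℝ} (hη : 0 < η) (hn : 2 ≤ n)
    (hp₁ : q / 2 ≤ p₁) (hr : η * n / Real.log n / 2 ≤ r)
    (hq : Real.log n ^ 2 / n ≤ η ^ 2 / 64 * q) (hlog : Real.log n ^ 3 / n ≤ η ^ 2 / 64) :
    4 * (n * Real.exp p₁⁻¹) * Real.exp (-(r : ℝ) ^ 2 / (4 * n)) ≤ 4 / n := by
  have hn0 : (0 : ℝ) < n := by have : 0 < n := by omega
                               exact_mod_cast this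
  have hL0 : 0 < Real.log n := Real.log_pos (by exact_mod_cast hn)
  set L := Real.log n with hL
  have hinv : p₁⁻¹ ≤ η ^ 2 * n / (32 * L ^ 2) := by
    have h10 : 32 * L ^ 2 / (η ^ 2 * n) ≤ p₁ := by
      refine le_trans ?_ hp₁
      have : 32 * L ^ 2 / (η ^ 2 * n) = 32 / η ^ 2 * (L ^ 2 / n) := by field_simp
      rw [this]
      calc 32 / η ^ 2 * (L ^ 2 / n) ≤ 32 / η ^ 2 * (η ^ 2 / 64 * q) := by gcongr
        _ = q / 2 := by field_simp; ring
    have h11 : 0 < 32 * L ^ 2 / (η ^ 2 * n) := by positivity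
    calc p₁⁻¹ ≤ (32 * L ^ 2 / (η ^ 2 * n))⁻¹ := inv_anti₀ h11 h10
      _ = _ := by rw [inv_div]
  have hsq : η ^ 2 * n / (16 * L ^ 2) ≤ (r : ℝ) ^ 2 / (4 * n) := by
    calc η ^ 2 * n / (16 * L ^ 2) = (η * n / L / 2) ^ 2 / (4 * n) := by field_simp; norm_num
      _ ≤ _ := by gcongr
  have hlog' : 2 * L ≤ η ^ 2 * n / (32 * L ^ 2) := by
    rw [div_le_iff₀ hn0] at hlog
    rw [le_div_iff₀ (by positivity)]
    linarith
  have hsplit : η ^ 2 * n / (16 * L ^ 2) =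
      η ^ 2 * n / (32 * L ^ 2) + η ^ 2 * n / (32 * L ^ 2) := by field_simp; norm_num
  calc 4 * (n * Real.exp p₁⁻¹) * Real.exp (-(r : ℝ) ^ 2 / (4 * n))
      = 4 * n * Real.exp (p₁⁻¹ + -(r : ℝ) ^ 2 / (4 * n)) := by rw [Real.exp_add]; ring
    _ ≤ 4 * n * Real.exp (-(2 * L)) := by
        gcongr
        rw [neg_div]; linarith
    _ = 4 / n := by
        have := Real.exp_nat_mul L 2
        rw [show Real.exp L = n from Real.exp_log hn0] at this
        push_cast at this
        rw [Real.exp_neg, this]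
        field_simp

lemma eventually_lower_bound (p : ℕ → I)
    (hp : (fun n : ℕ => Real.log n ^ 2 / n) =o[atTop] (fun n : ℕ => (p n : ℝ)))
    {ε : ℝ} (h0 : 0 < ε) (h1 : ε < 1) :
    ∀ᶠ n : ℕ in atTop, pr (piWeight (Fin n × Fin n) (bern (p n : ℝ)))
      (fun ω => ¬ ((1 - ε) ^ n * n.factorial * (p n : ℝ) ^ n ≤ ((cyclesIn ω).card : ℝ))) ≤
        4 / n + 4 / gapCount (ε / 4) n := by
  have hη0 : 0 < ε / 4 := by positivity
  have hγ0 : 0 < ε / 2 := by positivity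
  -- This use of the density hypothesis gives `p₂` the Hamiltonicity threshold on `r` vertices; `176
  -- = 2 * 88`, the `2` paying for the floor in `gapCount`. The next use controls `1/p₁` against `r²
  -- / n`.
  have ev1 := hp.bound (show 0 < ε / 2 * (ε / 4) / 176 by positivity)
  have ev2 := hp.bound (show 0 < (ε / 4) ^ 2 / 64 by positivity)
  have ev3 : ∀ᶠ n : ℕ in atTop, Real.log n ^ 3 / n < (ε / 4) ^ 2 / 64 :=
    (tendsto_log_pow_div_atTop 3).eventually (eventually_lt_nhds (by positivity))
  have ev4 : ∀ᶠ n : ℕ in atTop, 4 ≤ gapCount (ε / 4) n :=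
    (tendsto_gapCount hη0).eventually (eventually_ge_atTop 4)
  have ev5 : ∀ᶠ n : ℕ in atTop, Real.log n ^ 1 / n < ε / 12 :=
    (tendsto_log_pow_div_atTop 1).eventually (eventually_lt_nhds (by positivity))
  filter_upwards [ev1, ev2, ev3, ev4, ev5, eventually_ge_atTop 8] with n e1 e2 e3 e4 e5 hn
  have hq0 : 0 ≤ (p n : ℝ) := (p n).2.1
  have hq1 : (p n : ℝ) ≤ 1 := (p n).2.2
  generalize (p n : ℝ) = q at *
  have hn8 : (8 : ℝ) ≤ n := by exact_mod_cast hn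
  have hn0 : (0 : ℝ) < n := by linarith
  have hL1 : 1 ≤ Real.log n := by
    rw [Real.le_log_iff_exp_le hn0]
    linarith [Real.exp_one_lt_d9]
  have hL0 : 0 < Real.log n := by linarith
  rw [Real.norm_of_nonneg (by positivity), Real.norm_of_nonneg hq0] at e1 e2
  have hqpos : 0 < q := by
    refine lt_of_le_of_ne hq0 fun h => ?_
    rw [← h, mul_zero] at e1
    have : 0 < Real.log n ^ 2 / n := by positivity
    linarith
  have hrle : (gapCount (ε / 4) n : ℝ) ≤ ε / 4 * n / Real.log n := Nat.floor_le (by positivity)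
  have hlt : ε / 4 * n / Real.log n < gapCount (ε / 4) n + 1 := Nat.lt_floor_add_one _
  generalize gapCount (ε / 4) n = r at *
  have hr4 : (4 : ℝ) ≤ r := by exact_mod_cast e4
  have hr0 : (0 : ℝ) < r := by linarith
  have hrge : ε / 4 * n / Real.log n / 2 ≤ r := by linarith
  have hrL : r * Real.log n ≤ ε / 4 * n := (le_div_iff₀ hL0).1 hrle
  have hrn : r ≤ n := by
    have : (r : ℝ) ≤ n := by nlinarith
    exact_mod_cast this
  -- A fraction `ε / 2` of the density is reserved for completion; `p₁` is then forced by `1 - q =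
  -- (1 - p₁)(1 - p₂)` and is still at least `(1 - ε / 2) q`.
  obtain ⟨p₂, hp₂⟩ : ∃ p₂, p₂ = ε / 2 * q := ⟨_, rfl⟩
  have hp₂1 : p₂ ≤ ε / 2 := hp₂ ▸ mul_le_of_le_one_right hγ0.le hq1
  have hp₂0 : 0 ≤ p₂ := by rw [hp₂]; positivity
  have hd : 0 < 1 - p₂ := by linarith
  obtain ⟨p₁, hp₁⟩ : ∃ p₁, p₁ = (q - p₂) / (1 - p₂) := ⟨_, rfl⟩
  have hp₁ge : (1 - ε / 2) * q ≤ p₁ := by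
    rw [hp₁, le_div_iff₀ hd]
    have hx : 0 ≤ (1 - ε / 2) * q := mul_nonneg (by linarith) hq0
    have hy : 0 ≤ (1 - ε / 2) * q * p₂ := mul_nonneg hx hp₂0
    linarith
  have hp₁0 : 0 < p₁ := lt_of_lt_of_le (mul_pos (by linarith) hqpos) hp₁ge
  have hp₁1 : p₁ ≤ 1 := by rw [hp₁, div_le_one hd]; linarith
  have hpp : 1 - q = (1 - p₁) * (1 - p₂) := by rw [hp₁]; field_simp; ring
  have h88 : 88 * Real.log r / r ≤ p₂ := by
    have h3 : Real.log r ≤ Real.log n := Real.log_le_log hr0 (by exact_mod_cast hrn)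
    calc 88 * Real.log r / r ≤ 88 * Real.log n / (ε / 4 * n / Real.log n / 2) := by gcongr
      _ = 176 / (ε / 4) * (Real.log n ^ 2 / n) := by field_simp; norm_num
      _ ≤ 176 / (ε / 4) * (ε / 2 * (ε / 4) / 176 * q) := by gcongr
      _ = p₂ := by rw [hp₂]; field_simp
  have hw := (isProbWeight_bern hq0 hq1).pi (ι := Fin n × Fin n)
  have hlog : 3 * Real.log n ≤ ε / 4 * n := by
    rw [pow_one, div_lt_iff₀ hn0] at e5
    linarith
  have hmono := pr_mono hw (s := fun ω =>
      ¬ ((1 - ε) ^ n * n.factorial * q ^ n ≤ ((cyclesIn ω).card : ℝ)))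
    (t := fun ω => ¬ ((n.factorial : ℝ) * p₁ ^ n ≤ 4 * (n * (r.factorial * (cyclesIn ω).card))))
    (fun ω hω hc => hω (one_sub_pow_mul_factorial_le h0 h1 hq0 hn hrn hrL hlog hp₁ge
      (by positivity) hc))
  have hmain := pr_card_cyclesIn_lt_le e4 hrn hp₁0 hp₁1 (by linarith) hpp h88
  have htail := exp_inv_mul_exp_le hη0 (by omega) (le_trans (by nlinarith) hp₁ge) hrge e2 e3.le
  linarith

lemma tendsto_real_hamiltonCycleCount (p : ℕ → I)
    (hp : (fun n : ℕ => Real.log n ^ 2 / n) =o[atTop] (fun n : ℕ => (p n : ℝ)))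
    {ε : ℝ} (h0 : 0 < ε) (h1 : ε < 1) :
    Tendsto (fun n : ℕ => (Digraph.binomialRandom n (p n)).real
      {D : Digraph (Fin n) |
        (1 - ε) ^ n * (n.factorial : ℝ) * (p n : ℝ) ^ n ≤ (D.hamiltonCycleCount : ℝ) ∧
        (D.hamiltonCycleCount : ℝ) ≤ (1 + ε) ^ n * (n.factorial : ℝ) * (p n : ℝ) ^ n})
      atTop (𝓝 1) := by
  have hlow : Tendsto (fun n : ℕ => 1 - ((4 / (n : ℝ) + 4 / (gapCount (ε / 4) n : ℝ)) +
      1 / (1 + ε) ^ n)) atTop (𝓝 1) := by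
    have t1 : Tendsto (fun n : ℕ => 4 / (n : ℝ)) atTop (𝓝 0) :=
      tendsto_const_div_atTop_nhds_zero_nat 4
    have t2 : Tendsto (fun n : ℕ => 4 / (gapCount (ε / 4) n : ℝ)) atTop (𝓝 0) :=
      (tendsto_const_div_atTop_nhds_zero_nat 4).comp (tendsto_gapCount (by positivity))
    have t3 : Tendsto (fun n : ℕ => 1 / (1 + ε) ^ n) atTop (𝓝 0) := by
      simp only [one_div]
      exact (tendsto_pow_atTop_atTop_of_one_lt (by linarith)).inv_tendsto_atTop
    simpa using ((t1.add t2).add t3).const_sub 1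
  refine tendsto_of_tendsto_of_tendsto_of_le_of_le' hlow tendsto_const_nhds ?_
    (Eventually.of_forall fun n => measureReal_le_one)
  filter_upwards [eventually_lower_bound p hp h0 h1, hp.bound one_pos, eventually_ge_atTop 2]
    with n e1 e2 hn
  have hq1 : (p n : ℝ) ≤ 1 := (p n).2.2
  have hqpos : 0 < (p n : ℝ) := by
    have hlog : 0 < Real.log n := Real.log_pos (by exact_mod_cast hn)
    have hn0 : (0 : ℝ) < n := by have : 0 < n := by omega
                                 exact_mod_cast this
    rw [Real.norm_of_nonneg (by positivity), Real.norm_of_nonneg (p n).2.1, one_mul] at e2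
    exact lt_of_lt_of_le (by positivity) e2
  have hw := (isProbWeight_bern hqpos.le hq1).pi (ι := Fin n × Fin n)
  have e3 := pr_card_cyclesIn_gt_le (n := n) hqpos hq1 (show 0 < (1 + ε) ^ n by positivity)
  have e4 := Digraph.binomialRandom_real_eq_pr hn (p n) (fun m =>
    (1 - ε) ^ n * (n.factorial : ℝ) * (p n : ℝ) ^ n ≤ (m : ℝ) ∧
      (m : ℝ) ≤ (1 + ε) ^ n * (n.factorial : ℝ) * (p n : ℝ) ^ n)
  rw [e4]
  have e5 := pr_or_le hw
    (fun ω => ¬ ((1 - ε) ^ n * n.factorial * (p n : ℝ) ^ n ≤ ((cyclesIn ω).card : ℝ)))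
    (fun ω => ¬ (((cyclesIn ω).card : ℝ) ≤ (1 + ε) ^ n * n.factorial * (p n : ℝ) ^ n))
  simp only [← not_and_or] at e5
  rw [pr_not hw] at e5
  linarith

end Asymptotic

theorem theorem1p3 (p : ℕ → I)
    (hp : (fun n : ℕ => Real.log n ^ 2 / n) =o[atTop] (fun n : ℕ => (p n : ℝ))) :
    ∃ ε : ℕ → ℝ, (∀ n, 0 ≤ ε n ∧ ε n < 1) ∧ Tendsto ε atTop (𝓝 0) ∧
      Tendsto
        (fun n : ℕ => (Digraph.binomialRandom n (p n)).real
          {D : Digraph (Fin n) |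
            (1 - ε n) ^ n * (n.factorial : ℝ) * (p n : ℝ) ^ n ≤ (D.hamiltonCycleCount : ℝ) ∧
            (D.hamiltonCycleCount : ℝ) ≤ (1 + ε n) ^ n * (n.factorial : ℝ) * (p n : ℝ) ^ n})
        atTop (𝓝 1) := by
  -- The shift by `2` keeps the error strictly below `1` even at `k = 0`.
  have hpos : ∀ k : ℕ, 0 < 1 / ((k : ℝ) + 2) := fun k => by positivity
  have hlt : ∀ k : ℕ, 1 / ((k : ℝ) + 2) < 1 := fun k => by
    rw [div_lt_one (by positivity)]; linarith [Nat.cast_nonneg (α := ℝ) k]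
  obtain ⟨κ, hκ, hκ'⟩ := exists_tendsto_atTop_diagonal
    (fun k n => measureReal_le_one)
    (fun k => tendsto_real_hamiltonCycleCount p hp (hpos k) (hlt k))
  refine ⟨fun n => 1 / ((κ n : ℝ) + 2), fun n => ⟨(hpos _).le, hlt _⟩, ?_, hκ'⟩
  have h := ((tendsto_natCast_atTop_atTop (R := ℝ)).comp hκ).atTop_add
    (tendsto_const_nhds (x := (2 : ℝ)))
  simp only [one_div]
  exact h.inv_tendsto_atTop
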